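/- **Theorem.** Let $n\ge 1$. For sequences $t=(t_j)_{j\ge1}$, $s=(s_j)_{j\ge1}$ of complex times and $-\pi<\eta\le\theta<\pi$ let $$\tau_n(t,s;\eta,\theta)=\frac1{n!}\int_{[\theta,2\pi+\eta]^n}\ \prod_{1\le k<l\le n}|z_k-z_l|^2\ \prod_{k=1}^n e^{\sum_{j\ge1}(t_jz_k^j+s_jz_k^{-j})}\,\frac{dz_k}{2\pi i z_k},\qquad z_k=e^{i\varphi_k},$$ be the 2-Toda deformed gap probabilities of the unitary circular ensemble; here $dz_k/(2\pi i z_k)=d\varphi_k/(2\pi)$, and derivatives in $\eta,\theta$ are those of this integral formula for all real $\eta,\theta$ near the given point. Define, for $k\ge1$, $$L_k^{(n)}=\sum_{j=1}^{k-1}\frac{\partial^2}{\partial t_j\partial t_{k-j}}+n\frac{\partial}{\partial t_k}+\sum_{j\ge1}jt_j\frac{\partial}{\partial t_{j+k}}-\sum_{j\ge k+1}js_j\frac{\partial}{\partial s_{j-k}}-\sum_{j=1}^{k-1}js_j\frac{\partial}{\partial t_{k-j}}-nks_k,$$ $$L_0^{(n)}=\sum_{j\ge1}jt_j\frac{\partial}{\partial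 t_j}-\sum_{j\ge1}js_j\frac{\partial}{\partial s_j},$$ $$L_{-k}^{(n)}=-\sum_{j=1}^{k-1}\frac{\partial^2}{\partial s_j\partial s_{k-j}}-n\frac{\partial}{\partial s_k}-\sum_{j\ge1}js_j\frac{\partial}{\partial s_{j+k}}+\sum_{j\ge k+1}jt_j\frac{\partial}{\partial t_{j-k}}+\sum_{j=1}^{k-1}jt_j\frac{\partial}{\partial s_{k-j}}+nkt_k.$$ (i) For every $k\in\mathbb Z$, $$\frac1i\Big(e^{ik\theta}\frac{\partial}{\partial\theta}+e^{ik\eta}\frac{\partial}{\partial\eta}\Big)\tau_n(t,s;\eta,\theta)=L_k^{(n)}\tau_n(t,s;\eta,\theta).$$ This holds at all complex times with $\sum_j j|t_j|<\infty$ and $\sum_j j|s_j|<\infty$, where all the derivatives and infinite series that occur exist. It also holds, coefficient by coefficient, when $\tau_n$ is read as a formal power series in $t_1,t_2,\dots,s_1,s_2,\dots$ (the exponential in the integrand being expanded in powers of the times and integrated term by term); the coefficients of this series are differentiable in $\theta$ and in $\eta$. (ii) As operators on the space of formal power series in $t_1,t_2,\dots,s_1,s_2,\dots$ with complex coefficients,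 the $L_k^{(n)}$ satisfy the centerless Virasoro relations $$[L_k^{(n)},L_l^{(n)}]=(k-l)L_{k+l}^{(n)},\qquad k,l\in\mathbb Z.$$ -/

import Mathlib

noncomputable section

namespace CircularEnsemble

open scoped BigOperators

/-! ### The operators `L_k^{(n)}` -/

/-- The elementary operations out of which the Virasoro operators are built, on a space `V` of
objects depending on two sequences of times `t_1, t_2, …` and `s_1, s_2, …`. It is only used for
the two concrete instances `onFunctions` and `onSeries` below. -/
structure TimeOps (V : Type) where
  /-- the partial derivative `∂/∂t_j` -/
  dt : ℕ+ → V → V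
  /-- the partial derivative `∂/∂s_j` -/
  ds : ℕ+ → V → V
  /-- multiplication by `t_j` -/
  mt : ℕ+ → V → V
  /-- multiplication by `s_j` -/
  ms : ℕ+ → V → V
  /-- infinite sums `∑_{j ≥ 1}` -/
  sum : (ℕ+ → V) → V

section Operators

variable {V : Type} [AddCommGroup V] [Module ℂ V]

/-- `L_k^{(n)}` for `k ≥ 1`:
`∑_{j=1}^{k-1} ∂²/∂t_j∂t_{k-j} + n ∂/∂t_k + ∑_{j≥1} j t_j ∂/∂t_{j+k}
 - ∑_{j≥k+1} j s_j ∂/∂s_{j-k} - ∑_{j=1}^{k-1} j s_j ∂/∂t_{k-j} - n k s_k`. -/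
def virasoroPos (O : TimeOps V) (n : ℕ) (k : ℕ+) (f : V) : V :=
  (∑ j ∈ Finset.Ico 1 k, O.dt j (O.dt (k - j) f))
    + (n : ℂ) • O.dt k f
    + O.sum (fun j => (j : ℂ) • O.mt j (O.dt (j + k) f))
    - O.sum (fun j => if k < j then (j : ℂ) • O.ms j (O.ds (j - k) f) else 0)
    - (∑ j ∈ Finset.Ico 1 k, (j : ℂ) • O.ms j (O.dt (k - j) f))
    - ((n : ℂ) * (k : ℂ)) • O.ms k f

/-- `L_0^{(n)} = ∑_{j≥1} j t_j ∂/∂t_j - ∑_{j≥1} j s_j ∂/∂s_j`. -/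
def virasoroZero (O : TimeOps V) (f : V) : V :=
  O.sum (fun j => (j : ℂ) • O.mt j (O.dt j f)) - O.sum (fun j => (j : ℂ) • O.ms j (O.ds j f))

/-- `L_{-k}^{(n)}` for `k ≥ 1`:
`-∑_{j=1}^{k-1} ∂²/∂s_j∂s_{k-j} - n ∂/∂s_k - ∑_{j≥1} j s_j ∂/∂s_{j+k}
 + ∑_{j≥k+1} j t_j ∂/∂t_{j-k} + ∑_{j=1}^{k-1} j t_j ∂/∂s_{k-j} + n k t_k`. -/
def virasoroNeg (O : TimeOps V) (n : ℕ) (k : ℕ+) (f : V) : V :=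
  - (∑ j ∈ Finset.Ico 1 k, O.ds j (O.ds (k - j) f))
    - (n : ℂ) • O.ds k f
    - O.sum (fun j => (j : ℂ) • O.ms j (O.ds (j + k) f))
    + O.sum (fun j => if k < j then (j : ℂ) • O.mt j (O.dt (j - k) f) else 0)
    + (∑ j ∈ Finset.Ico 1 k, (j : ℂ) • O.mt j (O.ds (k - j) f))
    + ((n : ℂ) * (k : ℂ)) • O.mt k f

/-- The operators `L_k^{(n)}`, `k ∈ ℤ`. -/
def virasoro (O : TimeOps V) (n : ℕ) : ℤ → V → V
  | Int.ofNat 0 => virasoroZero O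
  | Int.ofNat (k + 1) => virasoroPos O n k.succPNat
  | Int.negSucc k => virasoroNeg O n k.succPNat

end Operators

/-- The operations on functions of the times `t = (t_j)_{j ≥ 1}`, `s = (s_j)_{j ≥ 1}`. -/
def onFunctions : TimeOps ((ℕ+ → ℂ) → (ℕ+ → ℂ) → ℂ) where
  dt j F := fun t s => deriv (fun u : ℂ => F (Function.update t j u) s) (t j)
  ds j F := fun t s => deriv (fun u : ℂ => F t (Function.update s j u)) (s j)
  mt j F := fun t s => t j * F t s
  ms j F := fun t s => s j * F t s
  sum F := fun t s => ∑' j, F j t s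

/-- The space of formal power series in `t_1, t_2, …` (the variables `Sum.inl j`) and
`s_1, s_2, …` (the variables `Sum.inr j`). -/
abbrev TimeSeries : Type := MvPowerSeries (ℕ+ ⊕ ℕ+) ℂ

/-- The operations on formal power series. Infinite sums are taken coefficientwise. In the
sums of the operators `L_k^{(n)}` the `j`-th term is divisible by `t_j` or by `s_j`, so that only
finitely many terms contribute to each coefficient. -/
def onSeries : TimeOps TimeSeries where
  dt j f := MvPowerSeries.pderiv ℂ (Sum.inl j) f
  ds j f := MvPowerSeries.pderiv ℂ (Sum.inr j) f
  mt j f := MvPowerSeries.X (Sum.inl j) * f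
  ms j f := MvPowerSeries.X (Sum.inr j) * f
  sum f := fun m => ∑ᶠ j, MvPowerSeries.coeff m (f j)

/-- All derivatives and infinite series that occur in the `L_k^{(n)} F`, `k ∈ ℤ`, exist at the
point `(t, s)`. -/
structure VirasoroDefinedAt (F : (ℕ+ → ℂ) → (ℕ+ → ℂ) → ℂ) (t s : ℕ+ → ℂ) : Prop where
  dt_exists : ∀ j, DifferentiableAt ℂ (fun u : ℂ => F (Function.update t j u) s) (t j)
  ds_exists : ∀ j, DifferentiableAt ℂ (fun u : ℂ => F t (Function.update s j u)) (s j)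
  dt_dt_exists : ∀ i j, DifferentiableAt ℂ
    (fun u : ℂ => onFunctions.dt j F (Function.update t i u) s) (t i)
  ds_ds_exists : ∀ i j, DifferentiableAt ℂ
    (fun u : ℂ => onFunctions.ds j F t (Function.update s i u)) (s i)
  summable_zero_t : Summable fun j : ℕ+ => (j : ℂ) * (t j * onFunctions.dt j F t s)
  summable_zero_s : Summable fun j : ℕ+ => (j : ℂ) * (s j * onFunctions.ds j F t s)
  summable_up_t : ∀ k : ℕ+, Summable fun j : ℕ+ =>
    (j : ℂ) * (t j * onFunctions.dt (j + k) F t s)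
  summable_up_s : ∀ k : ℕ+, Summable fun j : ℕ+ =>
    (j : ℂ) * (s j * onFunctions.ds (j + k) F t s)
  summable_down_t : ∀ k : ℕ+, Summable fun j : ℕ+ =>
    if k < j then (j : ℂ) * (t j * onFunctions.dt (j - k) F t s) else 0
  summable_down_s : ∀ k : ℕ+, Summable fun j : ℕ+ =>
    if k < j then (j : ℂ) * (s j * onFunctions.ds (j - k) F t s) else 0

/-! ### The tau functions -/

/-- The point `e^{iφ}` of the unit circle. -/
def circlePoint (φ : ℝ) : ℂ := Complex.exp (Complex.I * (φ : ℂ))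

/-- `|Δ_n(z)|² = ∏_{k < l} |z_k - z_l|²` with `z_k = e^{iφ_k}`. -/
def vandermondeSq {n : ℕ} (φ : Fin n → ℝ) : ℝ :=
  ∏ k : Fin n, ∏ l ∈ Finset.Ioi k, ‖circlePoint (φ k) - circlePoint (φ l)‖ ^ 2

/-- `exp (∑_{j ≥ 1} (t_j z^j + s_j z^{-j}))`. -/
def todaWeight (t s : ℕ+ → ℂ) (z : ℂ) : ℂ :=
  Complex.exp (∑' j : ℕ+, (t j * z ^ (j : ℕ) + s j * z⁻¹ ^ (j : ℕ)))

/-- The cube `[θ, 2π + η]^n` of angles. -/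
def angleCube (n : ℕ) (η θ : ℝ) : Set (Fin n → ℝ) :=
  Set.Icc (fun _ => θ) (fun _ => 2 * Real.pi + η)

/-- The 2-Toda deformed gap probabilities
`τ_n(t,s;η,θ) = (1/n!) ∫_{[θ,2π+η]^n} |Δ_n(z)|² ∏_k exp(∑_j (t_j z_k^j + s_j z_k^{-j}))
dz_k/(2πi z_k)`, where `dz_k/(2πi z_k) = dφ_k/(2π)` for `z_k = e^{iφ_k}`. -/
def tau (n : ℕ) (t s : ℕ+ → ℂ) (η θ : ℝ) : ℂ :=
  (1 / (n.factorial : ℂ)) * ∫ φ in angleCube n η θ,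
    (vandermondeSq φ : ℂ) *
      ∏ k : Fin n, (todaWeight t s (circlePoint (φ k)) * (1 / (2 * (Real.pi : ℂ))))

/-- The power sum multiplying a time in the exponent of `∏_k exp(∑_j (t_j z_k^j + s_j z_k^{-j}))`:
`∑_k z_k^j` for `t_j` and `∑_k z_k^{-j}` for `s_j`. -/
def powerSum {n : ℕ} (z : Fin n → ℂ) : ℕ+ ⊕ ℕ+ → ℂ
  | Sum.inl j => ∑ k, z k ^ (j : ℕ)
  | Sum.inr j => ∑ k, (z k)⁻¹ ^ (j : ℕ)

/-- `∏_k exp(∑_j (t_j z_k^j + s_j z_k^{-j})) = exp(∑_j (t_j ∑_k z_k^j + s_j ∑_k z_k^{-j}))`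
as a formal power series in the times: the coefficient of `∏_x x^{m_x}`, where `x` runs over the
times and `p_x` is the power sum that multiplies `x`, is `∏_x p_x^{m_x} / m_x!`. -/
def todaWeightSeries {n : ℕ} (z : Fin n → ℂ) : TimeSeries :=
  fun m => m.prod fun x e => powerSum z x ^ e / (e.factorial : ℂ)

/-- The tau function as a formal power series in the times: the integrand is expanded in powers of
the times and integrated coefficient by coefficient. -/
def tauSeries (n : ℕ) (η θ : ℝ) : TimeSeries :=
  fun m => (1 / (n.factorial : ℂ)) * ∫ φ in angleCube n η θ,
    (vandermondeSq φ : ℂ) *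
      (MvPowerSeries.coeff m (todaWeightSeries fun k => circlePoint (φ k)) *
        ∏ _k : Fin n, (1 / (2 * (Real.pi : ℂ))))

/-- `B_k(η,θ) = (1/i) (e^{ikθ} ∂/∂θ + e^{ikη} ∂/∂η)`, acting on functions of `(η, θ)`. -/
def boundaryOp (k : ℤ) (g : ℝ → ℝ → ℂ) (η θ : ℝ) : ℂ :=
  (1 / Complex.I) *
    (Complex.exp (Complex.I * (k : ℂ) * (θ : ℂ)) * deriv (fun θ' : ℝ => g η θ') θ
      + Complex.exp (Complex.I * (k : ℂ) * (η : ℂ)) * deriv (fun η' : ℝ => g η' θ) η)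

end CircularEnsemble

end

open MeasureTheory

namespace CircularEnsemble

/-! Put `J_y = ∂/∂t_y` for `y > 0`, `J_y = ∂/∂s_{-y}` for `y < 0` and `J_0 = n`. With the signed sum
`intSum`, all the operators take the single form `L_k = ∑_{0<j≤k} J_j J_{k-j} + ∑_x w_x T_x
J_{w_x+k}`, where `T_x` runs over the times and `w_x = ±j` is the power of `z` that `T_x` multiplies
(`apply_virasoro`).

Part (i) is a change of variables. Moving the faces of the cube with speeds `e^{ikθ}/i` and
`e^{ikη}/i` changes `∫ F` by `∫ ∑_a (1/i) ∂_a(z_a^k F)`, by the divergence theorem and periodicity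
(`boundaryOp_integral_angleCube`). The derivation `flow k`, that is `∑_a z_a^{k+1} ∂/∂z_a`,
multiplies `|Δ|²` by `∑_{0<j≤k} p_j p_{k-j} - k p_k`, with `p_y = ∑_a z_a^y` (`flow_vandermondeSq`);
the last term cancels the divergence `k p_k` of the field. On the Toda weight it produces the factor
`∑_x w_x T_x p_{w_x+k}`. Since `J_y` inserts `p_y` into the integral, the outcome is `L_k τ`. The
argument runs twice, with the exponential weight (`boundaryOp_tau`) and with its Taylor coefficients
(`boundaryOp_tauSeries`).

Part (ii) rests on two facts: the `J_y` commute, and `[J_y, D_k] = y J_{y+k}` for the part `D_k` of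
`L_k` linear in the times. The bracket `[D_k, D_l] = (k-l) D_{k+l}` holds because the difference of
its two sides commutes with all derivatives and has no constant coefficient. The quadratic parts
commute among themselves, and the cross terms reduce to the summation identity `intSum_virasoro`. No
central term arises because all the `J_y` in the quadratic part commute. -/

/-- The sum `∑_{0 < j ≤ k} f j`, extended to negative `k` as `-∑_{k < j ≤ 0} f j`. -/
def intSum {M : Type*} [AddCommGroup M] (f : ℤ → M) : ℤ → M
  | Int.ofNat k => ∑ i ∈ Finset.range k, f (i + 1)
  | Int.negSucc k => -∑ i ∈ Finset.range (k + 1), f (-i)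

/-! ### Signed sums over integer intervals. -/

section IntSum

variable {M N : Type*} [AddCommGroup M] [AddCommGroup N]

@[simp] theorem intSum_zero (f : ℤ → M) : intSum f 0 = 0 := by
  change ∑ i ∈ Finset.range 0, f (i + 1) = 0
  simp

theorem intSum_natCast (f : ℤ → M) (k : ℕ) :
    intSum f k = ∑ i ∈ Finset.range k, f (i + 1) := rfl

theorem intSum_neg_natCast (f : ℤ → M) (k : ℕ) :
    intSum f (-k) = -∑ i ∈ Finset.range k, f (-i) := by
  cases k with
  | zero => simp
  | succ k => rfl

theorem intSum_add_one (f : ℤ → M) (k : ℤ) : intSum f (k + 1) = intSum f k + f (k + 1) := by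
  obtain ⟨m, rfl | rfl⟩ := k.eq_nat_or_neg
  · have := intSum_natCast f (m + 1)
    push_cast at this
    rw [this, intSum_natCast, Finset.sum_range_succ]
  · cases m with
    | zero => simpa [Finset.sum_range_succ] using intSum_natCast f 1
    | succ m =>
      have : (-((m + 1 : ℕ) : ℤ) + 1) = -(m : ℤ) := by push_cast; ring
      rw [this, intSum_neg_natCast, intSum_neg_natCast, Finset.sum_range_succ]
      abel

/-- A signed sum is characterised by its value at `0` and its increments, in both directions; the
algebraic rules below all follow from this uniqueness. -/
theorem eq_intSum {f g : ℤ → M} (h0 : g 0 = 0) (h : ∀ k, g (k + 1) = g k + f (k + 1)) (k : ℤ) :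
    g k = intSum f k := by
  induction k using Int.induction_on with
  | zero => simp [h0]
  | succ i hi => rw [h, intSum_add_one, hi]
  | pred i hi =>
    have h1 := h (-(i : ℤ) - 1)
    have h2 := intSum_add_one f (-(i : ℤ) - 1)
    rw [sub_add_cancel] at h1 h2
    rw [h1, h2] at hi
    exact add_right_cancel hi

theorem intSum_map (φ : M →+ N) (f : ℤ → M) (k : ℤ) :
    φ (intSum f k) = intSum (fun j => φ (f j)) k :=
  eq_intSum (g := fun k => φ (intSum f k)) (by simp) (fun k => by simp [intSum_add_one]) k

theorem intSum_add (f g : ℤ → M) (k : ℤ) :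
    intSum (fun j => f j + g j) k = intSum f k + intSum g k :=
  (eq_intSum (g := fun k => intSum f k + intSum g k) (by simp)
    (fun k => by rw [intSum_add_one, intSum_add_one]; abel) k).symm

theorem intSum_sub (f g : ℤ → M) (k : ℤ) :
    intSum (fun j => f j - g j) k = intSum f k - intSum g k :=
  (eq_intSum (g := fun k => intSum f k - intSum g k) (by simp)
    (fun k => by rw [intSum_add_one, intSum_add_one]; abel) k).symm

theorem intSum_shift (f : ℤ → M) (l k : ℤ) :
    intSum (fun j => f (j + l)) k = intSum f (k + l) - intSum f l :=
  (eq_intSum (g := fun k => intSum f (k + l) - intSum f l) (by simp)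
    (fun k => by rw [show k + 1 + l = k + l + 1 by ring, intSum_add_one]; abel) k).symm

theorem intSum_sum {ι : Type*} (s : Finset ι) (f : ι → ℤ → M) (k : ℤ) :
    intSum (fun j => ∑ i ∈ s, f i j) k = ∑ i ∈ s, intSum (f i) k :=
  (eq_intSum (g := fun k => ∑ i ∈ s, intSum (f i) k) (by simp)
    (fun k => by simp_rw [intSum_add_one, Finset.sum_add_distrib]) k).symm

theorem intSum_const (c : M) (k : ℤ) : intSum (fun _ => c) k = k • c :=
  (eq_intSum (g := fun k : ℤ => k • c) (by simp) (fun k => by simp [add_smul]) k).symm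

/-- The identity behind the Virasoro relations between the quadratic parts. -/
theorem intSum_virasoro [Module ℂ M] (g : ℤ → M) (k l : ℤ) :
    intSum (fun j => (j : ℂ) • g (j + l) + ((k - j : ℤ) : ℂ) • g j) k
      - intSum (fun j => (j : ℂ) • g (j + k) + ((l - j : ℤ) : ℂ) • g j) l
      = ((k : ℂ) - (l : ℂ)) • intSum g (k + l) := by
  have smulc : ∀ (c : ℂ) (b : ℤ), intSum (fun j => c • g j) b = c • intSum g b := fun c b =>
    (intSum_map ((LinearMap.lsmul ℂ M c).toAddMonoidHom) g b).symm
  -- Writing `j g(j+b) = (j+b) g(j+b) - b g(j+b)` reduces everything to sums of `j g_j` and `g_j`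
  -- with limits `a`, `b`, `a+b`. Antisymmetrising in `a` and `b` cancels all but the sum of `g` up
  -- to `a+b`.
  have key : ∀ a b : ℤ, intSum (fun j => (j : ℂ) • g (j + b) + ((a - j : ℤ) : ℂ) • g j) a
      = intSum (fun j => (j : ℂ) • g j) (a + b) - intSum (fun j => (j : ℂ) • g j) b
        - (b : ℂ) • (intSum g (a + b) - intSum g b)
        + (a : ℂ) • intSum g a - intSum (fun j => (j : ℂ) • g j) a := by
    intro a b
    have h1 : (fun j : ℤ => (j : ℂ) • g (j + b) + ((a - j : ℤ) : ℂ) • g j) = fun j : ℤ =>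
        ((fun i : ℤ => (i : ℂ) • g i) (j + b) - (fun i : ℤ => (b : ℂ) • g i) (j + b))
          + ((a : ℂ) • g j - (j : ℂ) • g j) := by
      funext j
      push_cast
      module
    rw [h1, intSum_add, intSum_sub, intSum_sub,
      intSum_shift (fun i : ℤ => (i : ℂ) • g i), intSum_shift (fun i : ℤ => (b : ℂ) • g i),
      smulc, smulc, smulc]
    module
  rw [key, key, add_comm l k]
  module

/-- The geometric sum `(x - y) ∑_{0 < j ≤ k} x^j y^{k-j} = x (x^k - y^k)`. -/
theorem sub_mul_intSum_zpow {K : Type*} [Field K] {x y : K} (hx : x ≠ 0) (hy : y ≠ 0) (k : ℤ) :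
    (x - y) * intSum (fun j => x ^ j * y ^ (k - j)) k = x * (x ^ k - y ^ k) := by
  -- The upper limit `l` varies while the exponent `k` stays fixed, which makes the sum telescope;
  -- `l = k` is taken at the end.
  have h := eq_intSum (f := fun j => (x - y) * (x ^ j * y ^ (k - j)))
    (g := fun l => x ^ (l + 1) * y ^ (k - l) - x * y ^ k) (by simp) (fun l => by
      have e1 : k - l = k - (l + 1) + 1 := by ring
      rw [e1, zpow_add_one₀ hx (l + 1), zpow_add_one₀ hy (k - (l + 1))]
      ring) k
  have h2 := intSum_map (AddMonoidHom.mulLeft (x - y)) (fun j => x ^ j * y ^ (k - j)) k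
  simp only [AddMonoidHom.coe_mulLeft] at h2
  rw [h2, ← h, sub_self, zpow_zero, zpow_add_one₀ hx]
  ring

end IntSum

/-! ### Current modes and the uniform formula for the Virasoro operators. -/

/-- The exponent of `z` that a time multiplies: `j` for `t_j` and `-j` for `s_j`. -/
def weight : ℕ+ ⊕ ℕ+ → ℤ
  | Sum.inl j => ((j : ℕ) : ℤ)
  | Sum.inr j => -((j : ℕ) : ℤ)

namespace TimeOps

variable {V : Type}

/-- The partial derivative with respect to a time. -/
def der (O : TimeOps V) : ℕ+ ⊕ ℕ+ → V → V
  | Sum.inl j => O.dt j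
  | Sum.inr j => O.ds j

/-- Multiplication by a time. -/
def mul (O : TimeOps V) : ℕ+ ⊕ ℕ+ → V → V
  | Sum.inl j => O.mt j
  | Sum.inr j => O.ms j

/-- The mode of the current: `∂/∂t_j` for `j > 0`, `∂/∂s_{-j}` for `j < 0` and `n` for `j = 0`. -/
def mode [AddCommGroup V] [Module ℂ V] (O : TimeOps V) (n : ℕ) : ℤ → V → V
  | Int.ofNat 0 => fun f => (n : ℂ) • f
  | Int.ofNat (k + 1) => O.dt k.succPNat
  | Int.negSucc k => O.ds k.succPNat

variable [AddCommGroup V] [Module ℂ V] (O : TimeOps V) (n : ℕ)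

@[simp] theorem mode_zero (f : V) : O.mode n 0 f = (n : ℂ) • f := rfl

theorem mode_natCast (j : ℕ+) : O.mode n ((j : ℕ) : ℤ) = O.dt j := by
  obtain ⟨k, rfl⟩ : ∃ k : ℕ, j = k.succPNat := ⟨j.natPred, by simp⟩
  rfl

theorem mode_neg_natCast (j : ℕ+) : O.mode n (-((j : ℕ) : ℤ)) = O.ds j := by
  obtain ⟨k, rfl⟩ : ∃ k : ℕ, j = k.succPNat := ⟨j.natPred, by simp⟩
  rfl

theorem mode_weight (x : ℕ+ ⊕ ℕ+) : O.mode n (weight x) = O.der x := by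
  cases x with
  | inl j => exact O.mode_natCast n j
  | inr j => exact O.mode_neg_natCast n j

end TimeOps

theorem weight_ne_zero (x : ℕ+ ⊕ ℕ+) : weight x ≠ 0 := by
  cases x <;> simp [weight]

theorem exists_weight_eq {y : ℤ} (hy : y ≠ 0) : ∃ x, weight x = y := by
  obtain ⟨m, rfl | rfl⟩ := y.eq_nat_or_neg
  · exact ⟨Sum.inl ⟨m, by omega⟩, rfl⟩
  · exact ⟨Sum.inr ⟨m, by omega⟩, rfl⟩

theorem sum_Ico_one_eq_sum_range {M : Type*} [AddCommMonoid M] (g : ℤ → M) (k : ℕ) :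
    ∑ j ∈ Finset.Ico 1 k.succPNat, g ((j : ℕ) : ℤ) = ∑ i ∈ Finset.range k, g (i + 1) := by
  symm
  refine Finset.sum_bij (fun i _ => i.succPNat) ?_ ?_ ?_ ?_
  · intro i hi
    simp only [Finset.mem_range] at hi
    simp only [Finset.mem_Ico, one_le, true_and]
    exact Nat.succPNat_lt_succPNat.2 hi
  · intro i _ j _ h
    exact Nat.succPNat_injective h
  · intro j hj
    refine ⟨j.natPred, ?_, by simp⟩
    simp only [Finset.mem_Ico] at hj
    simp only [Finset.mem_range]
    have h2 : (j : ℕ) < k + 1 := hj.2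
    have := PNat.natPred_add_one j
    omega
  · intro i _
    simp

/-- Splitting off the terms `j < k` and `j = k` of a series. -/
theorem tsum_eq_tsum_lt_add {g : ℕ+ → ℂ} (hg : Summable g) (k : ℕ+) :
    ∑' j, g j = (∑' j, if k < j then g j else 0) + ∑ j ∈ Finset.Ico 1 k, g j + g k := by
  have h1 := hg.sum_add_tsum_compl (s := Finset.Ico 1 (k + 1))
  have h2 : ∑ j ∈ Finset.Ico 1 (k + 1), g j = ∑ j ∈ Finset.Ico 1 k, g j + g k := by
    have : Finset.Ico 1 (k + 1) = insert k (Finset.Ico 1 k) := by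
      ext j
      simp only [Finset.mem_Ico, Finset.mem_insert, one_le, true_and, PNat.lt_add_one_iff]
      exact le_iff_eq_or_lt
    rw [this, Finset.sum_insert (by simp), add_comm]
  have h3 : ∑' j : ↥(((Finset.Ico 1 (k + 1) : Finset ℕ+) : Set ℕ+)ᶜ), g j
      = ∑' j, if k < j then g j else 0 := by
    rw [tsum_subtype (((Finset.Ico 1 (k + 1) : Finset ℕ+) : Set ℕ+)ᶜ) g]
    refine tsum_congr fun j => ?_
    simp [Set.indicator_apply]
  rw [← h1, h2, h3]
  ring

theorem summable_ite_lt {g : ℕ+ → ℂ} (hg : Summable g) (k : ℕ+) :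
    Summable fun j => if k < j then g j else 0 := by
  have := hg.indicator {j | k < j}
  refine this.congr fun j => ?_
  simp [Set.indicator_apply]

/-- The uniform description of the Virasoro operators, after evaluation by a linear functional
for which the infinite sums that occur are convergent series. -/
theorem apply_virasoro {V : Type} [AddCommGroup V] [Module ℂ V] (O : TimeOps V) (n : ℕ)
    (ev : V →ₗ[ℂ] ℂ) (f : V)
    (hder : ∀ j, O.dt j ((n : ℂ) • f) = (n : ℂ) • O.dt j f)
    (hmul : ∀ x (c : ℂ) g, O.mul x (c • g) = c • O.mul x g)
    (hsum : ∀ (σ : ℕ+ → ℕ+ ⊕ ℕ+) (h : ℕ+ → V), σ = Sum.inl ∨ σ = Sum.inr →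
      (∀ j, ∃ (c : ℂ) (g : V), h j = c • O.mul (σ j) g) → ev (O.sum h) = ∑' j, ev (h j))
    (k : ℤ) (hs : Summable fun x => (weight x : ℂ) * ev (O.mul x (O.mode n (weight x + k) f))) :
    ev (virasoro O n k f) = intSum (fun j => ev (O.mode n j (O.mode n (k - j) f))) k
      + ∑' x, (weight x : ℂ) * ev (O.mul x (O.mode n (weight x + k) f)) := by
  have hst : Summable fun j : ℕ+ =>
      (j : ℂ) * ev (O.mt j (O.mode n (((j : ℕ) : ℤ) + k) f)) := by
    simpa [Function.comp_def, weight, TimeOps.mul] using hs.comp_injective Sum.inl_injective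
  have hss : Summable fun j : ℕ+ =>
      (j : ℂ) * ev (O.ms j (O.mode n (-((j : ℕ) : ℤ) + k) f)) := by
    simpa [Function.comp_def, weight, TimeOps.mul] using
      (hs.comp_injective Sum.inr_injective).neg
  have hsplit : ∑' x, (weight x : ℂ) * ev (O.mul x (O.mode n (weight x + k) f))
      = ∑' j : ℕ+, (j : ℂ) * ev (O.mt j (O.mode n (((j : ℕ) : ℤ) + k) f))
        - ∑' j : ℕ+, (j : ℂ) * ev (O.ms j (O.mode n (-((j : ℕ) : ℤ) + k) f)) := by
    rw [Summable.tsum_sum (hs.comp_injective Sum.inl_injective)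
      (hs.comp_injective Sum.inr_injective), sub_eq_add_neg, ← tsum_neg]
    simp [weight, TimeOps.mul]
  have hsumt : ∀ h : ℕ+ → V, (∀ j, ∃ (c : ℂ) (g : V), h j = c • O.mt j g) →
      ev (O.sum h) = ∑' j, ev (h j) := fun h => hsum Sum.inl h (Or.inl rfl)
  have hsums : ∀ h : ℕ+ → V, (∀ j, ∃ (c : ℂ) (g : V), h j = c • O.ms j g) →
      ev (O.sum h) = ∑' j, ev (h j) := fun h => hsum Sum.inr h (Or.inr rfl)
  have hmt : ∀ j (c : ℂ) g, O.mt j (c • g) = c • O.mt j g := fun j => hmul (Sum.inl j)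
  have hms : ∀ j (c : ℂ) g, O.ms j (c • g) = c • O.ms j g := fun j => hmul (Sum.inr j)
  rw [hsplit]
  clear hsplit hs
  match k with
  | Int.ofNat 0 =>
    change ev (virasoroZero O f) = intSum _ 0 + _
    rw [virasoroZero, map_sub, hsumt _ fun j => ⟨_, _, rfl⟩, hsums _ fun j => ⟨_, _, rfl⟩]
    simp [TimeOps.mode_natCast, TimeOps.mode_neg_natCast]
  | Int.ofNat (k + 1) =>
    change ev (virasoroPos O n k.succPNat f) = _
    have hK : (Int.ofNat (k + 1)) = ((k.succPNat : ℕ) : ℤ) := rfl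
    rw [hK] at hst hss ⊢
    have hup : ∀ j : ℕ+, O.mode n (((j : ℕ) : ℤ) + ((k.succPNat : ℕ) : ℤ)) f
        = O.dt (j + k.succPNat) f := fun j => by
      rw [← O.mode_natCast n (j + k.succPNat)]; simp
    have hdown : ∀ j : ℕ+, k.succPNat < j → O.mode n (-((j : ℕ) : ℤ) + ((k.succPNat : ℕ) : ℤ)) f
        = O.ds (j - k.succPNat) f := fun j hj => by
      rw [← O.mode_neg_natCast n (j - k.succPNat)]
      congr 1
      have := PNat.add_sub_of_lt hj
      have : (k.succPNat : ℕ) + ((j - k.succPNat : ℕ+) : ℕ) = j := by exact_mod_cast this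
      omega
    have hmid : ∀ j : ℕ+, j < k.succPNat → ∀ g, O.mode n (((k.succPNat : ℕ) : ℤ) - ((j : ℕ) : ℤ)) g
        = O.dt (k.succPNat - j) g := fun j hj g => by
      rw [← O.mode_natCast n (k.succPNat - j)]
      congr 1
      have := PNat.add_sub_of_lt hj
      have : (j : ℕ) + ((k.succPNat - j : ℕ+) : ℕ) = k.succPNat := by exact_mod_cast this
      omega
    -- The top term is `J_{k+1} J_0`, which becomes `n ∂/∂t_{k+1}`.
    rw [intSum_natCast, Nat.succPNat_coe, Finset.sum_range_succ,
      ← sum_Ico_one_eq_sum_range (fun j => ev (O.mode n j (O.mode n (((k + 1 : ℕ) : ℤ) - j) f))) k]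
    rw [← Nat.succPNat_coe]
    -- In the `s`-series the mode index `k + 1 - j` changes sign: `j < k + 1` gives `t`-derivatives,
    -- `j = k + 1` the scalar `n`, and `j > k + 1` gives `s`-derivatives.
    rw [tsum_eq_tsum_lt_add hss k.succPNat, virasoroPos]
    simp only [map_sub, map_add, map_sum, map_smul]
    rw [hsumt _ fun j => ⟨_, _, rfl⟩, hsums _ fun j => by
      split_ifs
      · exact ⟨_, _, rfl⟩
      · exact ⟨0, f, by simp⟩]
    have e1 : ∑ j ∈ Finset.Ico 1 k.succPNat, ev (O.dt j (O.dt (k.succPNat - j) f))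
        = ∑ j ∈ Finset.Ico 1 k.succPNat, ev (O.mode n ((j : ℕ) : ℤ)
          (O.mode n (((k + 1 : ℕ) : ℤ) - ((j : ℕ) : ℤ)) f)) :=
      Finset.sum_congr rfl fun j hj => by
        rw [← Nat.succ_eq_add_one, ← Nat.succPNat_coe, hmid j (Finset.mem_Ico.1 hj).2, O.mode_natCast]
    have e2 : ∑ j ∈ Finset.Ico 1 k.succPNat, (j : ℂ) • ev (O.ms j (O.dt (k.succPNat - j) f))
        = ∑ j ∈ Finset.Ico 1 k.succPNat, (j : ℂ) *
          ev (O.ms j (O.mode n (-((j : ℕ) : ℤ) + ((k.succPNat : ℕ) : ℤ)) f)) :=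
      Finset.sum_congr rfl fun j hj => by
        rw [neg_add_eq_sub, hmid j (Finset.mem_Ico.1 hj).2, smul_eq_mul]
    have e3 : (∑' j : ℕ+, ev (if k.succPNat < j then (j : ℂ) • O.ms j (O.ds (j - k.succPNat) f)
        else 0)) = ∑' j : ℕ+, if k.succPNat < j then
          (j : ℂ) * ev (O.ms j (O.mode n (-((j : ℕ) : ℤ) + ((k.succPNat : ℕ) : ℤ)) f)) else 0 :=
      tsum_congr fun j => by
        split_ifs with hj
        · rw [hdown j hj, map_smul, smul_eq_mul]
        · simp
    have e4 : (k : ℤ) + 1 = ((k.succPNat : ℕ) : ℤ) := by simp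
    -- Here `n` stands inside the derivative, so `hder` is needed. Full linearity of `O.dt` is not
    -- assumed, since it fails for `deriv` on arbitrary functions.
    rw [e1, e2, e3, e4, sub_self, neg_add_cancel, O.mode_zero, O.mode_natCast, hder, hms]
    simp only [hup, map_smul, smul_eq_mul]
    ring
  | Int.negSucc k =>
    change ev (virasoroNeg O n k.succPNat f) = _
    have hK : (Int.negSucc k) = -((k.succPNat : ℕ) : ℤ) := rfl
    rw [hK] at hst hss ⊢
    have hup : ∀ j : ℕ+, O.mode n (-((j : ℕ) : ℤ) + -((k.succPNat : ℕ) : ℤ)) f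
        = O.ds (j + k.succPNat) f := fun j => by
      rw [← O.mode_neg_natCast n (j + k.succPNat), PNat.add_coe]; congr 1; push_cast; ring
    have hdown : ∀ j : ℕ+, k.succPNat < j → O.mode n (((j : ℕ) : ℤ) + -((k.succPNat : ℕ) : ℤ)) f
        = O.dt (j - k.succPNat) f := fun j hj => by
      rw [← O.mode_natCast n (j - k.succPNat)]
      congr 1
      have := PNat.add_sub_of_lt hj
      have : (k.succPNat : ℕ) + ((j - k.succPNat : ℕ+) : ℕ) = j := by exact_mod_cast this
      omega
    have hmid : ∀ j : ℕ+, j < k.succPNat → ∀ g, O.mode n (-((k.succPNat : ℕ) : ℤ) + ((j : ℕ) : ℤ)) g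
        = O.ds (k.succPNat - j) g := fun j hj g => by
      rw [← O.mode_neg_natCast n (k.succPNat - j)]
      congr 1
      have := PNat.add_sub_of_lt hj
      have : (j : ℕ) + ((k.succPNat - j : ℕ+) : ℕ) = k.succPNat := by exact_mod_cast this
      omega
    -- For negative index the signed sum starts at `j = 0`, so the zero mode is the outer factor of
    -- the bottom term and `n` comes out without differentiating a multiple of `f`.
    rw [intSum_neg_natCast, Nat.succPNat_coe, Finset.sum_range_succ']
    have e0 := sum_Ico_one_eq_sum_range
      (fun j => ev (O.mode n (-j) (O.mode n (-((k + 1 : ℕ) : ℤ) - -j) f))) k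
    push_cast at e0 ⊢
    rw [← e0]
    have e4 : -(1 : ℤ) + -(k : ℤ) = -((k.succPNat : ℕ) : ℤ) := by simp
    have e5 : (k : ℤ) + 1 = ((k.succPNat : ℕ) : ℤ) := by simp
    rw [← Nat.cast_one (R := ℤ), ← Nat.cast_add, ← Nat.succ_eq_add_one, ← Nat.succPNat_coe]
    rw [tsum_eq_tsum_lt_add hst k.succPNat, virasoroNeg]
    simp only [map_sub, map_add, map_sum, map_smul, map_neg]
    rw [hsums _ fun j => ⟨_, _, rfl⟩, hsumt _ fun j => by
      split_ifs
      · exact ⟨_, _, rfl⟩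
      · exact ⟨0, f, by simp⟩]
    have e1 : ∑ j ∈ Finset.Ico 1 k.succPNat, ev (O.ds j (O.ds (k.succPNat - j) f))
        = ∑ j ∈ Finset.Ico 1 k.succPNat, ev (O.mode n (-((j : ℕ) : ℤ))
          (O.mode n (-((k.succPNat : ℕ) : ℤ) - -((j : ℕ) : ℤ)) f)) :=
      Finset.sum_congr rfl fun j hj => by
        rw [sub_neg_eq_add, hmid j (Finset.mem_Ico.1 hj).2, O.mode_neg_natCast]
    have e2 : ∑ j ∈ Finset.Ico 1 k.succPNat, (j : ℂ) • ev (O.mt j (O.ds (k.succPNat - j) f))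
        = ∑ j ∈ Finset.Ico 1 k.succPNat, (j : ℂ) *
          ev (O.mt j (O.mode n (((j : ℕ) : ℤ) + -((k.succPNat : ℕ) : ℤ)) f)) :=
      Finset.sum_congr rfl fun j hj => by
        rw [add_comm, hmid j (Finset.mem_Ico.1 hj).2, smul_eq_mul]
    have e3 : (∑' j : ℕ+, ev (if k.succPNat < j then (j : ℂ) • O.mt j (O.dt (j - k.succPNat) f)
        else 0)) = ∑' j : ℕ+, if k.succPNat < j then
          (j : ℂ) * ev (O.mt j (O.mode n (((j : ℕ) : ℤ) + -((k.succPNat : ℕ) : ℤ)) f)) else 0 :=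
      tsum_congr fun j => by
        split_ifs with hj
        · rw [hdown j hj, map_smul, smul_eq_mul]
        · simp
    rw [e1, e2, e3, add_neg_cancel, O.mode_zero, hmt]
    simp only [hup, map_smul, smul_eq_mul, neg_zero, sub_zero, O.mode_zero, O.mode_neg_natCast]
    ring

/-! ### The Virasoro relations on formal power series. -/

section Series

/-- This makes the infinite sums in the operators finite in each coefficient. -/
theorem coeff_X_mul_eq_zero {m : (ℕ+ ⊕ ℕ+) →₀ ℕ} {x : ℕ+ ⊕ ℕ+} (hx : x ∉ m.support)
    (f : TimeSeries) : MvPowerSeries.coeff m (MvPowerSeries.X x * f) = 0 := by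
  rw [MvPowerSeries.X_def, MvPowerSeries.coeff_monomial_mul, if_neg]
  intro h
  have := h x
  simp only [Finsupp.mem_support_iff, ne_eq, not_not] at hx
  simp [hx] at this

theorem onSeries_mul (x : ℕ+ ⊕ ℕ+) (f : TimeSeries) :
    onSeries.mul x f = MvPowerSeries.X x * f := by
  cases x <;> rfl

theorem onSeries_der (x : ℕ+ ⊕ ℕ+) (f : TimeSeries) :
    onSeries.der x f = MvPowerSeries.pderiv ℂ x f := by
  cases x <;> rfl

variable (n : ℕ)

/-- The modes of the current, as linear operators on power series. -/
noncomputable def seriesMode (y : ℤ) : Module.End ℂ TimeSeries where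
  toFun := onSeries.mode n y
  map_add' f g := by
    rcases eq_or_ne y 0 with rfl | hy
    · simp
    · obtain ⟨x, rfl⟩ := exists_weight_eq hy
      simp [TimeOps.mode_weight, onSeries_der]
  map_smul' c f := by
    rcases eq_or_ne y 0 with rfl | hy
    · exact smul_comm _ _ _
    · obtain ⟨x, rfl⟩ := exists_weight_eq hy
      simp [TimeOps.mode_weight, onSeries_der]

theorem seriesMode_zero : seriesMode n 0 = (n : ℂ) • 1 := rfl

theorem seriesMode_weight (x : ℕ+ ⊕ ℕ+) (f : TimeSeries) :
    seriesMode n (weight x) f = MvPowerSeries.pderiv ℂ x f := by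
  rw [← onSeries_der, ← TimeOps.mode_weight onSeries n]
  rfl

theorem seriesMode_commute (y z : ℤ) :
    seriesMode n y * seriesMode n z = seriesMode n z * seriesMode n y := by
  rcases eq_or_ne y 0 with rfl | hy
  · simp [seriesMode_zero]
  rcases eq_or_ne z 0 with rfl | hz
  · simp [seriesMode_zero]
  obtain ⟨x, rfl⟩ := exists_weight_eq hy
  obtain ⟨x', rfl⟩ := exists_weight_eq hz
  refine LinearMap.ext fun f => ?_
  simp only [Module.End.mul_apply, seriesMode_weight]
  rcases eq_or_ne x x' with rfl | hne
  · rfl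
  ext m
  simp only [MvPowerSeries.coeff_pderiv, Finsupp.add_apply, Finsupp.single_eq_of_ne hne,
    Finsupp.single_eq_of_ne hne.symm, add_zero]
  rw [add_right_comm]
  ring

/-- The part of the Virasoro operators that is linear in the times. -/
noncomputable def seriesDrift (k : ℤ) : Module.End ℂ TimeSeries where
  toFun f := fun m => ∑ x ∈ m.support,
    (weight x : ℂ) * MvPowerSeries.coeff m (MvPowerSeries.X x * seriesMode n (weight x + k) f)
  map_add' f g := by
    funext m
    refine Eq.trans ?_ Finset.sum_add_distrib
    exact Finset.sum_congr rfl fun x _ => by rw [map_add, mul_add, map_add, mul_add]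
  map_smul' c f := by
    funext m
    refine Eq.trans ?_ (Finset.mul_sum _ _ _).symm
    exact Finset.sum_congr rfl fun x _ => by
      rw [map_smul, mul_smul_comm, map_smul, smul_eq_mul, RingHom.id_apply]; ring

theorem coeff_seriesDrift (k : ℤ) (f : TimeSeries) (m : (ℕ+ ⊕ ℕ+) →₀ ℕ)
    {s : Finset (ℕ+ ⊕ ℕ+)} (hs : m.support ⊆ s) :
    MvPowerSeries.coeff m (seriesDrift n k f) = ∑ x ∈ s, (weight x : ℂ) *
      MvPowerSeries.coeff m (MvPowerSeries.X x * seriesMode n (weight x + k) f) :=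
  Finset.sum_subset hs fun x _ hx => by rw [coeff_X_mul_eq_zero hx, mul_zero]

/-- The commutation relation of the modes of the current with the linear part. -/
theorem seriesMode_mul_seriesDrift (y k : ℤ) : seriesMode n y * seriesDrift n k
    = seriesDrift n k * seriesMode n y + (y : ℂ) • seriesMode n (y + k) := by
  rcases eq_or_ne y 0 with rfl | hy
  · simp [seriesMode_zero]
  obtain ⟨x₀, rfl⟩ := exists_weight_eq hy
  refine LinearMap.ext fun f => ?_
  ext m
  simp only [Module.End.mul_apply, LinearMap.add_apply, LinearMap.smul_apply, map_add, map_smul,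
    smul_eq_mul]
  rw [seriesMode_weight, MvPowerSeries.coeff_pderiv]
  -- One finite index set serves both coefficients, at `m + e_{x₀}` and at `m`.
  have h1 : (m + Finsupp.single x₀ 1).support ⊆ insert x₀ m.support := by
    intro x hx
    by_contra h
    rw [Finset.mem_insert, not_or] at h
    simp only [Finsupp.mem_support_iff, not_not] at h hx
    simp [h.2, Finsupp.single_eq_of_ne h.1] at hx
  rw [coeff_seriesDrift n k f _ h1,
    coeff_seriesDrift n k _ m (Finset.subset_insert x₀ m.support), Finset.sum_mul]
  -- Leibniz rule: the derivative either passes to the series, where it commutes with the mode, or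
  -- hits the variable itself, which happens only for `x = x₀` and yields the commutator.
  have h2 : ∀ x, (weight x : ℂ) * MvPowerSeries.coeff (m + Finsupp.single x₀ 1)
        (MvPowerSeries.X x * seriesMode n (weight x + k) f) * ((m x₀ : ℂ) + 1)
      = (weight x : ℂ) * MvPowerSeries.coeff m
        (MvPowerSeries.X x * seriesMode n (weight x + k) (seriesMode n (weight x₀) f))
        + if x = x₀ then (weight x₀ : ℂ) * MvPowerSeries.coeff m (seriesMode n (weight x₀ + k) f)
          else 0 := by
    intro x
    rw [mul_assoc, ← MvPowerSeries.coeff_pderiv, Derivation.leibniz, ← seriesMode_weight n x₀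
      (seriesMode n (weight x + k) f), ← Module.End.mul_apply, seriesMode_commute,
      Module.End.mul_apply, map_add, smul_eq_mul, mul_add]
    congr 1
    split_ifs with h
    · subst h
      simp
    · simp [MvPowerSeries.pderiv_X_of_ne h]
  rw [Finset.sum_congr rfl fun x _ => h2 x, Finset.sum_add_distrib, Finset.sum_ite_eq',
    if_pos (Finset.mem_insert_self _ _)]

/-- Up to a nonzero integer factor, the coefficient of `D f` at `m + e_x` is that of `D (∂_x f)` at
`m`. Induction on `m`, with `f` arbitrary, descends to the constant coefficient. -/
theorem eq_zero_of_commute_seriesMode {D : Module.End ℂ TimeSeries}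
    (hD : ∀ y, seriesMode n y * D = D * seriesMode n y)
    (h0 : ∀ f, MvPowerSeries.coeff 0 (D f) = 0) : D = 0 := by
  refine LinearMap.ext fun f => ?_
  ext m
  rw [LinearMap.zero_apply, map_zero]
  induction m using Finsupp.induction generalizing f with
  | zero => exact h0 f
  | single_add x a m _ _ ih =>
    clear * - ih hD
    induction a generalizing f with
    | zero => simpa using ih f
    | succ a iha =>
      have h := congr(MvPowerSeries.coeff (Finsupp.single x a + m) ($(hD (weight x)) f))
      rw [Module.End.mul_apply, Module.End.mul_apply, seriesMode_weight,
        MvPowerSeries.coeff_pderiv, iha, add_right_comm, ← Finsupp.single_add] at h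
      refine (mul_eq_zero.1 h).resolve_right ?_
      exact Nat.cast_add_one_ne_zero _

theorem coeff_zero_seriesDrift (k : ℤ) (f : TimeSeries) :
    MvPowerSeries.coeff 0 (seriesDrift n k f) = 0 := by
  rw [coeff_seriesDrift n k f 0 (s := ∅) (by simp), Finset.sum_empty]

/-- By the Jacobi identity both sides have the same bracket with each mode, and both kill the
constant coefficient. This avoids rearranging double series. -/
theorem seriesDrift_commutator (k l : ℤ) :
    seriesDrift n k * seriesDrift n l - seriesDrift n l * seriesDrift n k
      = ((k : ℂ) - (l : ℂ)) • seriesDrift n (k + l) := by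
  rw [← sub_eq_zero]
  refine eq_zero_of_commute_seriesMode n (fun y => ?_) fun f => ?_
  · have h : ∀ a b, seriesMode n y * (seriesDrift n a * seriesDrift n b)
        = seriesDrift n a * seriesDrift n b * seriesMode n y
          + (y : ℂ) • (seriesDrift n a * seriesMode n (y + b))
          + (y : ℂ) • (seriesDrift n b * seriesMode n (y + a))
          + ((y : ℂ) * (y + a)) • seriesMode n (y + a + b) := by
      intro a b
      rw [← mul_assoc, seriesMode_mul_seriesDrift, add_mul, mul_assoc, seriesMode_mul_seriesDrift,
        mul_add, smul_mul_assoc, seriesMode_mul_seriesDrift, mul_smul_comm, smul_add, smul_smul,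
        ← mul_assoc]
      push_cast
      abel
    rw [mul_sub, mul_sub, h, h, mul_smul_comm, seriesMode_mul_seriesDrift, sub_mul, sub_mul,
      smul_mul_assoc, show y + l + k = y + (k + l) by ring, show y + k + l = y + (k + l) by ring]
    module
  · simp only [LinearMap.sub_apply, LinearMap.smul_apply, Module.End.mul_apply, map_sub, map_smul,
      coeff_zero_seriesDrift, sub_zero, smul_zero]

/-- The part of the Virasoro operators that is quadratic in the derivatives. -/
noncomputable def seriesQuad (k : ℤ) : Module.End ℂ TimeSeries :=
  intSum (fun j => seriesMode n j * seriesMode n (k - j)) k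

theorem seriesMode_commute_seriesQuad (y k : ℤ) :
    seriesMode n y * seriesQuad n k = seriesQuad n k * seriesMode n y := by
  have h1 := intSum_map (AddMonoidHom.mulLeft (seriesMode n y))
    (fun j => seriesMode n j * seriesMode n (k - j)) k
  have h2 := intSum_map (AddMonoidHom.mulRight (seriesMode n y))
    (fun j => seriesMode n j * seriesMode n (k - j)) k
  simp only [AddMonoidHom.coe_mulLeft, AddMonoidHom.mulRight_apply] at h1 h2
  rw [seriesQuad, h1, h2]
  congr 1
  funext j
  rw [← mul_assoc, seriesMode_commute n y j, mul_assoc, seriesMode_commute n y, mul_assoc]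

theorem seriesQuad_commute (k l : ℤ) :
    seriesQuad n k * seriesQuad n l = seriesQuad n l * seriesQuad n k := by
  have h1 := intSum_map (AddMonoidHom.mulLeft (seriesQuad n k))
    (fun j => seriesMode n j * seriesMode n (l - j)) l
  have h2 := intSum_map (AddMonoidHom.mulRight (seriesQuad n k))
    (fun j => seriesMode n j * seriesMode n (l - j)) l
  simp only [AddMonoidHom.coe_mulLeft, AddMonoidHom.mulRight_apply] at h1 h2
  rw [seriesQuad.eq_def n l, h1, h2]
  congr 1
  funext j
  rw [← mul_assoc, ← seriesMode_commute_seriesQuad, mul_assoc, ← seriesMode_commute_seriesQuad,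
    mul_assoc]

/-- Bracketing with the drift is a derivation that shifts the index of one mode by `l`; the indices
of each product then add up to `k + l`, as `intSum_virasoro` requires. -/
theorem seriesQuad_mul_seriesDrift (k l : ℤ) :
    seriesQuad n k * seriesDrift n l - seriesDrift n l * seriesQuad n k
      = intSum (fun j => (j : ℂ) • (seriesMode n (j + l) * seriesMode n (k + l - (j + l)))
        + ((k - j : ℤ) : ℂ) • (seriesMode n j * seriesMode n (k + l - j))) k := by
  have h1 := intSum_map (AddMonoidHom.mulLeft (seriesDrift n l))
    (fun j => seriesMode n j * seriesMode n (k - j)) k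
  have h2 := intSum_map (AddMonoidHom.mulRight (seriesDrift n l))
    (fun j => seriesMode n j * seriesMode n (k - j)) k
  simp only [AddMonoidHom.coe_mulLeft, AddMonoidHom.mulRight_apply] at h1 h2
  rw [seriesQuad, h1, h2, ← intSum_sub]
  congr 1
  funext j
  rw [mul_assoc, seriesMode_mul_seriesDrift, mul_add, ← mul_assoc, seriesMode_mul_seriesDrift,
    show k + l - (j + l) = k - j by ring, show k - j + l = k + l - j by ring, mul_smul_comm,
    add_mul, smul_mul_assoc, ← mul_assoc]
  abel

/-- The Virasoro operators on power series, as linear operators. -/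
noncomputable def seriesVirasoro (k : ℤ) : Module.End ℂ TimeSeries := seriesQuad n k + seriesDrift n k

theorem seriesVirasoro_commutator (k l : ℤ) :
    seriesVirasoro n k * seriesVirasoro n l - seriesVirasoro n l * seriesVirasoro n k
      = ((k : ℂ) - (l : ℂ)) • seriesVirasoro n (k + l) := by
  have h1 := seriesQuad_mul_seriesDrift n k l
  have h2 := seriesQuad_mul_seriesDrift n l k
  rw [add_comm l k] at h2
  have h3 := intSum_virasoro (fun j => seriesMode n j * seriesMode n (k + l - j)) k l
  rw [← h1, ← h2] at h3
  rw [seriesVirasoro, seriesVirasoro, seriesVirasoro, smul_add, ← seriesDrift_commutator,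
    seriesQuad.eq_def n (k + l), ← h3]
  simp only [add_mul, mul_add]
  rw [seriesQuad_commute n k l]
  abel

theorem finsum_eq_tsum_of_support {f : ℕ+ → ℂ} (hf : f.support.Finite) :
    ∑ᶠ j, f j = ∑' j, f j := (tsum_eq_finsum (L := .unconditional _) hf).symm

theorem coeff_onSeries_sum {σ : ℕ+ → ℕ+ ⊕ ℕ+} (hσ : Function.Injective σ)
    {h : ℕ+ → TimeSeries} (hh : ∀ j, ∃ (c : ℂ) (g : TimeSeries), h j = c • onSeries.mul (σ j) g)
    (m : (ℕ+ ⊕ ℕ+) →₀ ℕ) :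
    MvPowerSeries.coeff m (onSeries.sum h) = ∑' j, MvPowerSeries.coeff m (h j) := by
  refine finsum_eq_tsum_of_support ?_
  refine (m.support.finite_toSet.preimage hσ.injOn).subset fun j hj => ?_
  by_contra hm
  obtain ⟨c, g, e⟩ := hh j
  refine hj ?_
  change MvPowerSeries.coeff m (h j) = 0
  rw [e, onSeries_mul, map_smul, coeff_X_mul_eq_zero hm, smul_zero]

theorem virasoro_onSeries (k : ℤ) (f : TimeSeries) :
    virasoro onSeries n k f = seriesVirasoro n k f := by
  ext m
  have hzero : ∀ x ∉ m.support, (weight x : ℂ) * MvPowerSeries.coeff m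
      (onSeries.mul x (onSeries.mode n (weight x + k) f)) = 0 := fun x hx => by
    rw [onSeries_mul, coeff_X_mul_eq_zero hx, mul_zero]
  have h := apply_virasoro onSeries n (MvPowerSeries.coeff m) f
    (fun j => (MvPowerSeries.pderiv ℂ (Sum.inl j)).map_smul _ _)
    (fun x c g => by rw [onSeries_mul, onSeries_mul, mul_smul_comm])
    (fun σ h hσ hh => coeff_onSeries_sum
      (by rcases hσ with rfl | rfl; exacts [Sum.inl_injective, Sum.inr_injective]) hh m) k
    (summable_of_ne_finset_zero hzero)
  rw [h, tsum_eq_sum hzero, seriesVirasoro, LinearMap.add_apply, map_add,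
    coeff_seriesDrift n k f m subset_rfl]
  congr 1
  · have := intSum_map ((MvPowerSeries.coeff m).toAddMonoidHom.comp
      (LinearMap.applyₗ (R := ℂ) f).toAddMonoidHom)
      (fun j => seriesMode n j * seriesMode n (k - j)) k
    exact this.symm
  · exact Finset.sum_congr rfl fun x _ => by rw [onSeries_mul]; rfl

theorem virasoro_onSeries_commutator (k l : ℤ) (f : TimeSeries) :
    virasoro onSeries n k (virasoro onSeries n l f) - virasoro onSeries n l (virasoro onSeries n k f)
      = ((k : ℂ) - (l : ℂ)) • virasoro onSeries n (k + l) f := by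
  simp only [virasoro_onSeries]
  exact congr($(seriesVirasoro_commutator n k l) f)

end Series

/-! ### Differentiation under the integral sign. -/

section ParametricIntegral

/-- Differentiation under the integral sign over a compact set. -/
theorem hasDerivAt_setIntegral_of_continuous {𝕜 E X : Type*} [RCLike 𝕜] [NormedAddCommGroup E]
    [NormedSpace ℝ E] [NormedSpace 𝕜 E] [TopologicalSpace X] [T2Space X]
    [MeasurableSpace X] [OpensMeasurableSpace X] [SecondCountableTopologyEither X E]
    {μ : Measure X} [IsFiniteMeasureOnCompacts μ]
    {K : Set X} (hK : IsCompact K) {f f' : 𝕜 → X → E} (hf : ∀ s, Continuous (f s))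
    (hf' : Continuous (Function.uncurry f')) (hd : ∀ s x, HasDerivAt (fun s => f s x) (f' s x) s)
    (s₀ : 𝕜) : HasDerivAt (fun s => ∫ x in K, f s x ∂μ) (∫ x in K, f' s₀ x ∂μ) s₀ := by
  -- Joint continuity on the compact product of a ball of parameters with `K` supplies a constant
  -- dominating function.
  obtain ⟨C, hC⟩ := ((isCompact_closedBall s₀ 1).prod hK).exists_bound_of_continuousOn
    hf'.continuousOn
  have hint : ∀ g : X → E, Continuous g → IntegrableOn g K μ := fun g hg =>
    hg.continuousOn.integrableOn_compact hK
  have hms : MeasurableSet K := hK.measurableSet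
  refine (hasDerivAt_integral_of_dominated_loc_of_deriv_le (F' := f') (bound := fun _ => C)
    (Metric.closedBall_mem_nhds s₀ one_pos)
    (Filter.Eventually.of_forall fun s => (hint _ (hf s)).aestronglyMeasurable) (hint _ (hf s₀))
    (hint _ (hf'.comp (Continuous.prodMk_right s₀))).aestronglyMeasurable ?_
    (integrableOn_const (C := C) hK.measure_lt_top.ne) ?_).2
  · exact (ae_restrict_iff' hms).2 (Filter.Eventually.of_forall fun x hx s hs => hC (s, x) ⟨hs, hx⟩)
  · exact Filter.Eventually.of_forall fun x s _ => hd s x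

end ParametricIntegral

/-! ### Calculus on cubes with moving faces. -/

section Cube

variable {n : ℕ}

open scoped Pointwise in
theorem setIntegral_cube_eq (G : (Fin n → ℝ) → ℂ) {α β : ℝ} (h : α < β) :
    ∫ φ in Set.Icc (fun _ => α) (fun _ => β), G φ
      = ((β - α) ^ n : ℝ) • ∫ u in Set.Icc (0 : Fin n → ℝ) 1, G (fun a => α + (β - α) * u a) := by
  have hr : 0 < β - α := sub_pos.2 h
  have h1 := Measure.setIntegral_comp_smul_of_pos (volume : Measure (Fin n → ℝ))
    (fun x => G ((fun _ => α) + x)) (Set.Icc (0 : Fin n → ℝ) 1) hr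
  have h2 : (β - α) • Set.Icc (0 : Fin n → ℝ) 1 = Set.Icc 0 (fun _ => β - α) := by
    rw [← Set.image_smul]
    have := (OrderIso.smulRight hr (β := Fin n → ℝ)).image_Icc 0 1
    simp only [OrderIso.smulRight_apply, smul_zero] at this
    rw [this]
    congr 1
    ext; simp
  have h3 := (measurePreserving_add_left (volume : Measure (Fin n → ℝ))
    (fun _ => α)).setIntegral_preimage_emb (measurableEmbedding_addLeft _) G
    (Set.Icc (fun _ => α) (fun _ => β))
  rw [Set.preimage_const_add_Icc, sub_self] at h3
  have h4 : ((fun _ => β : Fin n → ℝ) - fun _ => α) = fun _ => β - α := rfl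
  rw [h4] at h3
  rw [← h3, ← h2]
  have h5 : ∫ u in Set.Icc (0 : Fin n → ℝ) 1, G (fun a => α + (β - α) * u a)
      = ∫ u in Set.Icc (0 : Fin n → ℝ) 1, G ((fun _ => α) + (β - α) • u) := rfl
  rw [h5, h1, smul_smul, Module.finrank_fin_fun, mul_inv_cancel₀ (pow_pos hr n).ne', one_smul]

theorem fderiv_apply_eq_sum (F : (Fin n → ℝ) → ℂ) (φ v : Fin n → ℝ) :
    fderiv ℝ F φ v = ∑ a, (v a : ℂ) * fderiv ℝ F φ (Pi.single a 1) := by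
  conv_lhs => rw [← Finset.univ_sum_single v]
  rw [map_sum]
  refine Finset.sum_congr rfl fun a _ => ?_
  have : Pi.single a (v a) = v a • (Pi.single a 1 : Fin n → ℝ) := by
    rw [← Pi.single_smul, smul_eq_mul, mul_one]
  rw [this, map_smul, Complex.real_smul]

/-- The derivative of the integral over a cube whose faces move linearly. -/
theorem hasDerivAt_integral_cube {F : (Fin n → ℝ) → ℂ} (hF : ContDiff ℝ 1 F)
    (a₀ a₁ b₀ b₁ s₀ : ℝ) (h : a₀ + a₁ * s₀ < b₀ + b₁ * s₀) :
    HasDerivAt (fun s => ∫ φ in Set.Icc (fun _ => a₀ + a₁ * s) (fun _ => b₀ + b₁ * s), F φ)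
      (∫ φ in Set.Icc (fun _ => a₀ + a₁ * s₀) (fun _ => b₀ + b₁ * s₀), ∑ a,
        ((((b₁ - a₁) / (b₀ + b₁ * s₀ - (a₀ + a₁ * s₀)) : ℝ) : ℂ) * F φ
          + (((a₁ * (b₀ + b₁ * s₀ - φ a) + b₁ * (φ a - (a₀ + a₁ * s₀)))
            / (b₀ + b₁ * s₀ - (a₀ + a₁ * s₀)) : ℝ) : ℂ) * fderiv ℝ F φ (Pi.single a 1))) s₀ := by
  set r : ℝ → ℝ := fun s => b₀ + b₁ * s - (a₀ + a₁ * s) with hr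
  -- Pulling back to the unit cube moves the parameter from the domain into the integrand, with
  -- Jacobian `r s ^ n`.
  set ψ : ℝ → (Fin n → ℝ) → (Fin n → ℝ) := fun s u a => a₀ + a₁ * s + r s * u a with hψ
  have hrd : ∀ s, HasDerivAt r (b₁ - a₁) s := fun s => by
    exact ((((hasDerivAt_id s).const_mul b₁).const_add b₀).sub
      (((hasDerivAt_id s).const_mul a₁).const_add a₀)).congr_deriv (by simp)
  have hψd : ∀ s u, HasDerivAt (fun s => ψ s u) (fun a => a₁ + (b₁ - a₁) * u a) s := fun s u => by
    refine hasDerivAt_pi.2 fun a => ?_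
    exact ((((hasDerivAt_id s).const_mul a₁).const_add a₀).add
      ((hrd s).mul_const (u a))).congr_deriv (by simp)
  have hFd : Differentiable ℝ F := hF.differentiable one_ne_zero
  have hF'c : Continuous (fderiv ℝ F) := hF.continuous_fderiv one_ne_zero
  have hrc : Continuous r := by fun_prop
  have hψc : Continuous (Function.uncurry ψ) := by
    refine continuous_pi fun a => ?_
    simp only [hψ, Function.uncurry_def]
    fun_prop
  have key := hasDerivAt_setIntegral_of_continuous (μ := (volume : Measure (Fin n → ℝ)))
    (isCompact_Icc (a := (0 : Fin n → ℝ)) (b := 1))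
    (f := fun s u => (r s ^ n : ℝ) • F (ψ s u))
    (f' := fun s u => (r s ^ n : ℝ) • fderiv ℝ F (ψ s u) (fun a => a₁ + (b₁ - a₁) * u a)
      + (n * r s ^ (n - 1) * (b₁ - a₁) : ℝ) • F (ψ s u))
    (fun s => (hF.continuous.comp (hψc.comp (Continuous.prodMk_right s))).const_smul (r s ^ n : ℝ))
    (by
      simp only [Function.uncurry_def] at hψc ⊢
      have h1 : Continuous fun p : ℝ × (Fin n → ℝ) => F (ψ p.1 p.2) := hF.continuous.comp hψc
      have h2 : Continuous fun p : ℝ × (Fin n → ℝ) =>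
          fderiv ℝ F (ψ p.1 p.2) (fun a => a₁ + (b₁ - a₁) * p.2 a) :=
        (hF'c.comp hψc).clm_apply (continuous_pi fun a => by fun_prop)
      fun_prop)
    (fun s u => by
      have h1 := (hFd (ψ s u)).hasFDerivAt.comp_hasDerivAt s (hψd s u)
      exact (((hrd s).pow n).smul h1).congr_deriv (by simp)) s₀
  have hpos : 0 < r s₀ := sub_pos.2 h
  have hev : (fun s => ∫ φ in Set.Icc (fun _ : Fin n => a₀ + a₁ * s) (fun _ => b₀ + b₁ * s), F φ)
      =ᶠ[nhds s₀] fun s => ∫ u in Set.Icc (0 : Fin n → ℝ) 1, (r s ^ n : ℝ) • F (ψ s u) := by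
    filter_upwards [(hrc.tendsto s₀).eventually (lt_mem_nhds hpos)] with s hs
    rw [setIntegral_cube_eq F (sub_pos.1 hs), ← integral_smul]
  refine (key.congr_of_eventuallyEq hev).congr_deriv ?_
  rw [setIntegral_cube_eq _ h, ← integral_smul]
  refine integral_congr_ae (Filter.Eventually.of_forall fun u => ?_)
  have hne : b₀ + b₁ * s₀ - (a₀ + a₁ * s₀) ≠ 0 := hpos.ne'
  simp only
  rw [Finset.sum_add_distrib, Finset.sum_const, Finset.card_univ, Fintype.card_fin, smul_add,
    add_comm]
  congr 1
  · rw [nsmul_eq_mul, Complex.real_smul, Complex.real_smul]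
    change _ = _ * (_ * (_ * F (ψ s₀ u)))
    rw [← mul_assoc, ← mul_assoc]
    congr 1
    -- The Jacobian contributes `n r^{n-1}`, to be compared with `r^n · n / r`; for `n = 0` the
    -- truncated exponent is harmless, as both sides vanish.
    rcases n with _ | m
    · simp
    · change _ = (((r s₀) ^ (m + 1) : ℝ) : ℂ) * _ * (((b₁ - a₁) / r s₀ : ℝ) : ℂ)
      have hne' : (r s₀ : ℂ) ≠ 0 := by exact_mod_cast hpos.ne'
      push_cast
      rw [pow_succ]
      field_simp
  · rw [fderiv_apply_eq_sum]
    congr 1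
    refine Finset.sum_congr rfl fun a _ => ?_
    congr 2
    field_simp
    ring

/-- The divergence theorem on a cube for a field that vanishes at the faces. -/
theorem integral_cube_divergence_eq_zero {F : (Fin n → ℝ) → ℂ} (hF : ContDiff ℝ 1 F)
    {h h' : ℝ → ℂ} (hh : ∀ x, HasDerivAt h (h' x) x) (hh' : Continuous h') {α β : ℝ} (hαβ : α ≤ β)
    (hα : h α = 0) (hβ : h β = 0) :
    ∫ φ in Set.Icc (fun _ => α) (fun _ => β), ∑ a,
      (h' (φ a) * F φ + h (φ a) * fderiv ℝ F φ (Pi.single a 1)) = 0 := by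
  -- The divergence theorem is used in dimension `n + 1`; in dimension zero the sum is empty.
  rcases n with _ | n
  · simp
  have hhc : Continuous h := continuous_iff_continuousAt.2 fun x => (hh x).continuousAt
  have hFd : Differentiable ℝ F := hF.differentiable one_ne_zero
  have hF'c : Continuous (fderiv ℝ F) := hF.continuous_fderiv one_ne_zero
  have hFc := hF.continuous
  have hd : ∀ (a : Fin (n + 1)) (φ : Fin (n + 1) → ℝ), HasFDerivAt (fun φ => h (φ a) * F φ)
      (h (φ a) • fderiv ℝ F φ + F φ • ((ContinuousLinearMap.toSpanSingleton ℝ (h' (φ a))).comp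
        (ContinuousLinearMap.proj (R := ℝ) (φ := fun _ : Fin (n + 1) => ℝ) a))) φ := fun a φ =>
    ((hh (φ a)).hasFDerivAt.comp φ (ContinuousLinearMap.proj (R := ℝ)
      (φ := fun _ : Fin (n + 1) => ℝ) a).hasFDerivAt).mul (hFd φ).hasFDerivAt
  have hval : ∀ (a : Fin (n + 1)) (φ : Fin (n + 1) → ℝ),
      (h (φ a) • fderiv ℝ F φ + F φ • ((ContinuousLinearMap.toSpanSingleton ℝ (h' (φ a))).comp
        (ContinuousLinearMap.proj (R := ℝ) (φ := fun _ : Fin (n + 1) => ℝ) a))) (Pi.single a 1)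
        = h' (φ a) * F φ + h (φ a) * fderiv ℝ F φ (Pi.single a 1) := fun a φ => by
    simp; ring
  have key := integral_divergence_of_hasFDerivAt_off_countable' (fun _ : Fin (n + 1) => α)
    (fun _ => β) (fun _ => hαβ) (fun a φ => h (φ a) * F φ) _ ∅ Set.countable_empty
    (fun a => by fun_prop) (fun φ _ a => hd a φ) (by
      simp only [hval]
      refine Continuous.integrableOn_Icc ?_
      refine continuous_finsetSum _ fun a _ => ?_
      have : Continuous fun φ => fderiv ℝ F φ (Pi.single a 1) := hF'c.clm_apply continuous_const
      fun_prop)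
  simp only [hval] at key
  rw [key]
  simp [hα, hβ]

end Cube

/-! ### Powers of points on the unit circle. -/

section CirclePoint

theorem circlePoint_ne_zero (x : ℝ) : circlePoint x ≠ 0 := Complex.exp_ne_zero _

theorem norm_circlePoint (x : ℝ) : ‖circlePoint x‖ = 1 := by
  rw [circlePoint, mul_comm]; exact Complex.norm_exp_ofReal_mul_I x

theorem circlePoint_zpow (x : ℝ) (k : ℤ) :
    circlePoint x ^ k = Complex.exp (Complex.I * (k : ℂ) * (x : ℂ)) := by
  rw [circlePoint, ← Complex.exp_int_mul]
  congr 1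
  ring

theorem norm_circlePoint_zpow (x : ℝ) (k : ℤ) : ‖circlePoint x ^ k‖ = 1 := by
  rw [norm_zpow, norm_circlePoint, one_zpow]

theorem hasDerivAt_circlePoint_zpow (k : ℤ) (x : ℝ) :
    HasDerivAt (fun x : ℝ => circlePoint x ^ k) (Complex.I * k * circlePoint x ^ k) x := by
  simp_rw [circlePoint_zpow]
  have h := ((Complex.ofRealCLM.hasDerivAt (x := x)).const_mul (Complex.I * (k : ℂ))).cexp
  refine h.congr_deriv ?_
  simp only [Complex.ofRealCLM_apply, Complex.ofReal_one]
  ring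

theorem contDiff_circlePoint_zpow (k : ℤ) : ContDiff ℝ 1 fun x : ℝ => circlePoint x ^ k := by
  simp_rw [circlePoint_zpow]
  have : ContDiff ℝ 1 fun x : ℝ => (x : ℂ) := Complex.ofRealCLM.contDiff
  fun_prop

theorem continuous_circlePoint_zpow (k : ℤ) : Continuous fun x : ℝ => circlePoint x ^ k :=
  (contDiff_circlePoint_zpow k).continuous

theorem circlePoint_add_two_pi_zpow (x : ℝ) (k : ℤ) :
    circlePoint (2 * Real.pi + x) ^ k = circlePoint x ^ k := by
  congr 1
  rw [circlePoint, circlePoint]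
  push_cast
  rw [mul_add, Complex.exp_add, show Complex.I * (2 * (Real.pi : ℂ)) = 2 * Real.pi * Complex.I by
    ring, Complex.exp_two_pi_mul_I, one_mul]

end CirclePoint

/-! ### The boundary operator as the integral of a divergence. -/

section Boundary

variable {n : ℕ}

theorem hasDerivAt_integral_angleCube_right {F : (Fin n → ℝ) → ℂ} (hF : ContDiff ℝ 1 F)
    {η θ : ℝ} (h : θ < 2 * Real.pi + η) :
    HasDerivAt (fun θ' => ∫ φ in angleCube n η θ', F φ)
      (∫ φ in angleCube n η θ, ∑ a, (((-1 / (2 * Real.pi + η - θ) : ℝ) : ℂ) * F φ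
        + (((2 * Real.pi + η - φ a) / (2 * Real.pi + η - θ) : ℝ) : ℂ)
          * fderiv ℝ F φ (Pi.single a 1))) θ := by
  have := hasDerivAt_integral_cube hF 0 1 (2 * Real.pi + η) 0 θ (by simpa using h)
  simpa [angleCube] using this

theorem hasDerivAt_integral_angleCube_left {F : (Fin n → ℝ) → ℂ} (hF : ContDiff ℝ 1 F)
    {η θ : ℝ} (h : θ < 2 * Real.pi + η) :
    HasDerivAt (fun η' => ∫ φ in angleCube n η' θ, F φ)
      (∫ φ in angleCube n η θ, ∑ a, (((1 / (2 * Real.pi + η - θ) : ℝ) : ℂ) * F φ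
        + (((φ a - θ) / (2 * Real.pi + η - θ) : ℝ) : ℂ)
          * fderiv ℝ F φ (Pi.single a 1))) η := by
  have := hasDerivAt_integral_cube hF θ 0 (2 * Real.pi) 1 η (by simpa using h)
  simpa [angleCube] using this

/-- Differentiating in the end points gives the divergence of `F` times a field that is affine in
each angle. Only the values of a field on the faces matter, so the affine field may be replaced by
`z_a^k`. -/
theorem boundaryOp_integral_angleCube {F : (Fin n → ℝ) → ℂ} (hF : ContDiff ℝ 1 F)
    {η θ : ℝ} (h : θ < 2 * Real.pi + η) (k : ℤ) :
    boundaryOp k (fun η' θ' => ∫ φ in angleCube n η' θ', F φ) η θ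
      = ∫ φ in angleCube n η θ, ∑ a, circlePoint (φ a) ^ k *
        (k * F φ + 1 / Complex.I * fderiv ℝ F φ (Pi.single a 1)) := by
  have hF'c : ∀ a, Continuous fun φ => fderiv ℝ F φ (Pi.single a 1) := fun a =>
    (hF.continuous_fderiv one_ne_zero).clm_apply continuous_const
  have hFc := hF.continuous
  rw [boundaryOp, (hasDerivAt_integral_angleCube_right hF h).deriv,
    (hasDerivAt_integral_angleCube_left hF h).deriv, ← circlePoint_zpow, ← circlePoint_zpow]
  have hr : ((2 * Real.pi + η - θ : ℝ) : ℂ) ≠ 0 := by exact_mod_cast (sub_pos.2 h).ne'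
  set r : ℂ := ((2 * Real.pi + η - θ : ℝ) : ℂ) with hrdef
  -- The field is the affine interpolation between `e^{ikθ}` and `e^{ikη}` minus `e^{ikx}`. It
  -- vanishes at `θ`, and at `2π + η` because `k` is an integer.
  have hd := integral_cube_divergence_eq_zero hF
    (h := fun x => (circlePoint θ ^ k * ((2 * Real.pi + η : ℝ) - x : ℂ)
      + circlePoint η ^ k * (x - θ : ℂ)) / r - circlePoint x ^ k)
    (h' := fun x => (circlePoint θ ^ k * (-1) + circlePoint η ^ k * 1) / r
      - Complex.I * k * circlePoint x ^ k)
    (fun x => by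
      have hx : HasDerivAt (fun x : ℝ => (x : ℂ)) 1 x := Complex.ofRealCLM.hasDerivAt
      exact ((((hx.const_sub _).const_mul _).add ((hx.sub_const _).const_mul _)).div_const _).sub
        (hasDerivAt_circlePoint_zpow k x))
    (by have := continuous_circlePoint_zpow k; fun_prop) h.le
    (by
      have : ((2 * Real.pi + η : ℝ) - θ : ℂ) = r := by rw [hrdef]; push_cast; ring
      rw [this, sub_self, mul_zero, add_zero, mul_div_cancel_right₀ _ hr, sub_self])
    (by
      have : ((2 * Real.pi + η : ℝ) - θ : ℂ) = r := by rw [hrdef]; push_cast; ring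
      rw [this, sub_self, mul_zero, zero_add, mul_div_cancel_right₀ _ hr,
        circlePoint_add_two_pi_zpow, sub_self])
  have hint : ∀ f : (Fin n → ℝ) → ℂ, Continuous f → IntegrableOn f (angleCube n η θ) :=
    fun f hf => hf.integrableOn_Icc
  have hsum : ∀ f : Fin n → (Fin n → ℝ) → ℂ, (∀ a, Continuous (f a)) →
      Continuous fun φ => ∑ a, f a φ := fun f hf => continuous_finsetSum _ fun a _ => hf a
  have hz := continuous_circlePoint_zpow k
  rw [← integral_const_mul, ← integral_const_mul, ← integral_add
    ((hint _ (hsum _ fun a => by fun_prop)).const_mul _)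
    ((hint _ (hsum _ fun a => by fun_prop)).const_mul _), ← integral_const_mul, ← sub_eq_zero,
    ← integral_sub]
  · have h0 := congr(1 / Complex.I * $hd)
    rw [← integral_const_mul, mul_zero] at h0
    rw [← h0]
    refine integral_congr_ae (Filter.Eventually.of_forall fun φ => ?_)
    simp only
    simp only [Finset.mul_sum, ← Finset.sum_add_distrib, ← Finset.sum_sub_distrib]
    refine Finset.sum_congr rfl fun a _ => ?_
    have hI := Complex.I_ne_zero
    rw [Complex.ofReal_div, Complex.ofReal_div, Complex.ofReal_div, Complex.ofReal_div, ← hrdef]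
    push_cast
    field_simp
    ring
  · exact (((hint _ (hsum _ fun a => by fun_prop)).const_mul _).add
      ((hint _ (hsum _ fun a => by fun_prop)).const_mul _)).const_mul _
  · exact hint _ (hsum _ fun a => (hz.comp (continuous_apply a)).mul (by fun_prop))

end Boundary

/-! ### The vector fields `∑_a z_a^{k+1} ∂/∂z_a` and the Vandermonde factor. -/

section Flow

variable {n : ℕ}

/-- The vector field `∑_a z_a^{k+1} ∂/∂z_a` on functions of the angles. -/
noncomputable def flow (k : ℤ) (F : (Fin n → ℝ) → ℂ) (φ : Fin n → ℝ) : ℂ :=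
  ∑ a, circlePoint (φ a) ^ k * (1 / Complex.I * fderiv ℝ F φ (Pi.single a 1))

theorem flow_sub {F G : (Fin n → ℝ) → ℂ} {φ : Fin n → ℝ} (k : ℤ) (hF : DifferentiableAt ℝ F φ)
    (hG : DifferentiableAt ℝ G φ) :
    flow k (fun φ => F φ - G φ) φ = flow k F φ - flow k G φ := by
  simp only [flow, ← Finset.sum_sub_distrib, fderiv_fun_sub hF hG, sub_apply]
  exact Finset.sum_congr rfl fun a _ => by ring

theorem flow_sum {ι : Type*} {s : Finset ι} {F : ι → (Fin n → ℝ) → ℂ} {φ : Fin n → ℝ} (k : ℤ)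
    (hF : ∀ i ∈ s, DifferentiableAt ℝ (F i) φ) :
    flow k (fun φ => ∑ i ∈ s, F i φ) φ = ∑ i ∈ s, flow k (F i) φ := by
  simp only [flow, fderiv_fun_sum hF, sum_apply, Finset.mul_sum]
  exact Finset.sum_comm

theorem flow_mul {F G : (Fin n → ℝ) → ℂ} {φ : Fin n → ℝ} (k : ℤ) (hF : DifferentiableAt ℝ F φ)
    (hG : DifferentiableAt ℝ G φ) :
    flow k (fun φ => F φ * G φ) φ = flow k F φ * G φ + F φ * flow k G φ := by
  simp only [flow, Finset.sum_mul, Finset.mul_sum, ← Finset.sum_add_distrib, fderiv_fun_mul hF hG,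
    add_apply, smul_apply, smul_eq_mul]
  exact Finset.sum_congr rfl fun a _ => by ring

@[simp] theorem flow_const (k : ℤ) (c : ℂ) (φ : Fin n → ℝ) : flow k (fun _ => c) φ = 0 := by
  simp [flow]

/-- Stated without logarithmic derivatives because it is also applied to powers of power sums, which
may vanish. -/
theorem flow_prod {ι : Type*} [DecidableEq ι] {s : Finset ι} {F : ι → (Fin n → ℝ) → ℂ}
    {φ : Fin n → ℝ} (k : ℤ) (hF : ∀ i ∈ s, DifferentiableAt ℝ (F i) φ) :
    flow k (fun φ => ∏ i ∈ s, F i φ) φ = ∑ i ∈ s, (∏ j ∈ s.erase i, F j φ) * flow k (F i) φ := by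
  have h : fderiv ℝ (fun φ => ∏ i ∈ s, F i φ) φ
      = ∑ i ∈ s, (∏ j ∈ s.erase i, F j φ) • fderiv ℝ (F i) φ :=
    (HasFDerivAt.finsetProd fun i hi => (hF i hi).hasFDerivAt).fderiv
  simp only [flow, h, sum_apply, smul_apply, smul_eq_mul,
    Finset.mul_sum]
  rw [Finset.sum_comm]
  exact Finset.sum_congr rfl fun i _ => Finset.sum_congr rfl fun a _ => by ring

/-- The flow of a product whose factors have known logarithmic derivatives. -/
theorem flow_prod_of_eq_mul {ι : Type*} {s : Finset ι} {F : ι → (Fin n → ℝ) → ℂ} {q : ι → ℂ}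
    {φ : Fin n → ℝ} (k : ℤ) (hF : ∀ i ∈ s, DifferentiableAt ℝ (F i) φ)
    (hq : ∀ i ∈ s, flow k (F i) φ = F i φ * q i) :
    flow k (fun φ => ∏ i ∈ s, F i φ) φ = (∏ i ∈ s, F i φ) * ∑ i ∈ s, q i := by
  classical
  rw [flow_prod k hF, Finset.mul_sum]
  refine Finset.sum_congr rfl fun i hi => ?_
  rw [hq i hi, ← mul_assoc, Finset.prod_erase_mul _ _ hi]

theorem flow_comp_apply (k : ℤ) (b : Fin n) {h : ℝ → ℂ} {h' : ℂ} {φ : Fin n → ℝ}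
    (hh : HasDerivAt h h' (φ b)) :
    flow k (fun φ => h (φ b)) φ = circlePoint (φ b) ^ k * (1 / Complex.I * h') := by
  have hd : HasFDerivAt (fun φ : Fin n → ℝ => h (φ b))
      ((ContinuousLinearMap.toSpanSingleton ℝ h').comp
        (ContinuousLinearMap.proj (R := ℝ) (φ := fun _ : Fin n => ℝ) b)) φ :=
    hh.hasFDerivAt.comp φ (ContinuousLinearMap.proj (R := ℝ)
      (φ := fun _ : Fin n => ℝ) b).hasFDerivAt
  rw [flow, hd.fderiv, Finset.sum_eq_single b]
  · simp
  · intro a _ hab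
    simp [hab.symm]
  · simp

theorem flow_zpow (k j : ℤ) (b : Fin n) (φ : Fin n → ℝ) :
    flow k (fun φ => circlePoint (φ b) ^ j) φ = j * circlePoint (φ b) ^ (j + k) := by
  rw [flow_comp_apply k b (hasDerivAt_circlePoint_zpow j (φ b)),
    zpow_add₀ (circlePoint_ne_zero _)]
  have := Complex.I_ne_zero
  field_simp

theorem contDiff_circlePoint_apply_zpow (b : Fin n) (j : ℤ) :
    ContDiff ℝ 1 fun φ : Fin n → ℝ => circlePoint (φ b) ^ j :=
  (contDiff_circlePoint_zpow j).comp (contDiff_apply ℝ ℝ b)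

/-- The power sum `∑_a z_a^y`, as a function of the angles. -/
noncomputable def anglePowerSum (y : ℤ) (φ : Fin n → ℝ) : ℂ := ∑ a, circlePoint (φ a) ^ y

theorem contDiff_anglePowerSum (y : ℤ) : ContDiff ℝ 1 (anglePowerSum (n := n) y) :=
  ContDiff.sum fun a _ => contDiff_circlePoint_apply_zpow a y

theorem continuous_anglePowerSum (y : ℤ) : Continuous (anglePowerSum (n := n) y) :=
  (contDiff_anglePowerSum y).continuous

theorem anglePowerSum_zero (φ : Fin n → ℝ) : anglePowerSum 0 φ = n := by simp [anglePowerSum]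

theorem norm_anglePowerSum_le (y : ℤ) (φ : Fin n → ℝ) : ‖anglePowerSum y φ‖ ≤ n := by
  refine (norm_sum_le _ _).trans ?_
  simp [norm_circlePoint_zpow, -norm_zpow]

theorem flow_anglePowerSum (k y : ℤ) (φ : Fin n → ℝ) :
    flow k (anglePowerSum y) φ = y * anglePowerSum (y + k) φ := by
  have := flow_sum (s := Finset.univ) (F := fun (a : Fin n) φ => circlePoint (φ a) ^ y) (φ := φ) k
    fun a _ => ((contDiff_circlePoint_apply_zpow a y).differentiable one_ne_zero) φ
  rw [anglePowerSum, Finset.mul_sum]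
  exact this.trans (Finset.sum_congr rfl fun a _ => flow_zpow k y a φ)

/-- The factor `|z_a - z_b|²` as `(z_a - z_b)(z_a⁻¹ - z_b⁻¹)`. -/
noncomputable def pairFactor (a b : Fin n) (φ : Fin n → ℝ) : ℂ :=
  (circlePoint (φ a) ^ (1 : ℤ) - circlePoint (φ b) ^ (1 : ℤ))
    * (circlePoint (φ a) ^ (-1 : ℤ) - circlePoint (φ b) ^ (-1 : ℤ))

theorem contDiff_pairFactor (a b : Fin n) : ContDiff ℝ 1 (pairFactor a b) :=
  ((contDiff_circlePoint_apply_zpow a 1).sub (contDiff_circlePoint_apply_zpow b 1)).mul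
    ((contDiff_circlePoint_apply_zpow a (-1)).sub (contDiff_circlePoint_apply_zpow b (-1)))

theorem ofReal_vandermondeSq (φ : Fin n → ℝ) :
    (vandermondeSq φ : ℂ) = ∏ a, ∏ b ∈ Finset.Ioi a, pairFactor a b φ := by
  rw [vandermondeSq]
  push_cast
  refine Finset.prod_congr rfl fun a _ => Finset.prod_congr rfl fun b _ => ?_
  have hconj : ∀ x, (starRingEnd ℂ) (circlePoint x) = (circlePoint x)⁻¹ := fun x => by
    rw [Complex.inv_def, Complex.normSq_eq_norm_sq, norm_circlePoint]
    simp
  rw [← Complex.mul_conj', map_sub, hconj, hconj, pairFactor, zpow_one, zpow_one, zpow_neg_one,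
    zpow_neg_one]

theorem contDiff_vandermondeSq : ContDiff ℝ 1 fun φ : Fin n → ℝ => (vandermondeSq φ : ℂ) := by
  simp_rw [ofReal_vandermondeSq]
  exact contDiff_prod fun a _ => contDiff_prod fun b _ => contDiff_pairFactor a b

theorem flow_pairFactor (k : ℤ) (a b : Fin n) (φ : Fin n → ℝ) :
    flow k (pairFactor a b) φ = pairFactor a b φ *
      (intSum (fun j => circlePoint (φ a) ^ j * circlePoint (φ b) ^ (k - j)) k
        + intSum (fun j => circlePoint (φ b) ^ j * circlePoint (φ a) ^ (k - j)) k) := by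
  have hd : ∀ (c : Fin n) (j : ℤ), DifferentiableAt ℝ
      (fun φ : Fin n → ℝ => circlePoint (φ c) ^ j) φ := fun c j =>
    (contDiff_circlePoint_apply_zpow c j).differentiable one_ne_zero φ
  have h : flow k (pairFactor a b) φ = _ :=
    flow_mul k ((hd a 1).fun_sub (hd b 1)) ((hd a (-1)).fun_sub (hd b (-1)))
  rw [h, flow_sub k (hd _ _) (hd _ _), flow_sub k (hd _ _) (hd _ _), flow_zpow, flow_zpow,
    flow_zpow, flow_zpow, pairFactor]
  have hx := circlePoint_ne_zero (φ a)
  have hy := circlePoint_ne_zero (φ b)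
  set x := circlePoint (φ a)
  set y := circlePoint (φ b)
  have h1 := sub_mul_intSum_zpow hx hy k
  have h2 := sub_mul_intSum_zpow hy hx k
  set S := intSum (fun j => x ^ j * y ^ (k - j)) k
  set S' := intSum (fun j => y ^ j * x ^ (k - j)) k
  have hinv : x⁻¹ - y⁻¹ = -(x - y) / (x * y) := by field_simp; ring
  simp only [zpow_add₀ hx, zpow_add₀ hy, zpow_one, zpow_neg_one, Int.cast_one, Int.cast_neg, hinv]
  -- The points may coincide, so `x - y` is absorbed into the geometric sums and never divided out.
  have h3 : (x - y) * (-(x - y) / (x * y)) * (S + S')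
      = -(x - y) / (x * y) * ((x - y) * S - (y - x) * S') := by ring
  rw [h3, h1, h2]
  field_simp
  ring

/-- The function `∑_{0 < j ≤ k} p_j p_{k-j}` of the angles. -/
noncomputable def angleQuad (k : ℤ) (φ : Fin n → ℝ) : ℂ :=
  intSum (fun j => anglePowerSum j φ * anglePowerSum (k - j) φ) k

/-- In the expanded product of power sums, the diagonal pairs `a = b` give `z_a^k` once for each
`j`, hence `k p_k`; the off-diagonal pairs are grouped by unordered pair. -/
theorem angleQuad_eq (k : ℤ) (φ : Fin n → ℝ) :
    angleQuad k φ = k * anglePowerSum k φ + ∑ a, ∑ b ∈ Finset.Ioi a,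
      (intSum (fun j => circlePoint (φ a) ^ j * circlePoint (φ b) ^ (k - j)) k
        + intSum (fun j => circlePoint (φ b) ^ j * circlePoint (φ a) ^ (k - j)) k) := by
  have h := Finset.sum_sum_Ioi_add_eq_sum_sum_off_diag fun b a : Fin n =>
    intSum (fun j => circlePoint (φ a) ^ j * circlePoint (φ b) ^ (k - j)) k
  rw [h, angleQuad]
  simp only [anglePowerSum, Finset.sum_mul_sum]
  simp only [intSum_sum, Finset.mul_sum]
  rw [← Finset.sum_add_distrib]
  refine Finset.sum_congr rfl fun a _ => ?_
  rw [← Finset.sum_add_sum_compl {a}, Finset.sum_singleton]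
  congr 1
  simp_rw [← zpow_add₀ (circlePoint_ne_zero _), add_sub_cancel]
  rw [intSum_const, zsmul_eq_mul]

theorem flow_vandermondeSq (k : ℤ) (φ : Fin n → ℝ) :
    flow k (fun φ => (vandermondeSq φ : ℂ)) φ
      = vandermondeSq φ * (angleQuad k φ - k * anglePowerSum k φ) := by
  have hd : ∀ (a b : Fin n), DifferentiableAt ℝ (pairFactor a b) φ := fun a b =>
    (contDiff_pairFactor a b).differentiable one_ne_zero φ
  simp_rw [ofReal_vandermondeSq]
  rw [angleQuad_eq, add_sub_cancel_left]
  refine flow_prod_of_eq_mul k (fun a _ => ?_) fun a _ => ?_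
  · exact (contDiff_prod fun b _ => contDiff_pairFactor a b).differentiable one_ne_zero φ
  · exact flow_prod_of_eq_mul k (fun b _ => hd a b) fun b _ => flow_pairFactor k a b φ

theorem continuous_angleQuad (k : ℤ) : Continuous (angleQuad (n := n) k) := by
  have h : ∀ x y : ℤ, Continuous fun φ : Fin n → ℝ =>
      anglePowerSum x φ * anglePowerSum y φ := fun x y =>
    (continuous_anglePowerSum x).mul (continuous_anglePowerSum y)
  unfold angleQuad
  obtain ⟨m, rfl | rfl⟩ := k.eq_nat_or_neg
  · simp_rw [intSum_natCast]
    exact continuous_finsetSum _ fun i _ => h _ _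
  · simp_rw [intSum_neg_natCast]
    exact (continuous_finsetSum _ fun i _ => h _ _).neg

theorem continuous_flow (k : ℤ) {E : (Fin n → ℝ) → ℂ} (hE : ContDiff ℝ 1 E) :
    Continuous (flow k E) := by
  refine continuous_finsetSum _ fun a _ => ?_
  have h1 : Continuous fun φ => fderiv ℝ E φ (Pi.single a 1) :=
    (hE.continuous_fderiv one_ne_zero).clm_apply continuous_const
  have h2 := (contDiff_circlePoint_apply_zpow a k).continuous
  fun_prop

end Flow

/-! ### Means over the gap cube against the squared Vandermonde. -/

section GapMean

/-- The integral of a function of the angles over the cube against `|Δ_n|² / (n! (2π)^n)`. -/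
noncomputable def gapMean (n : ℕ) (η θ : ℝ) (E : (Fin n → ℝ) → ℂ) : ℂ :=
  (1 / (n.factorial : ℂ)) * ∫ φ in angleCube n η θ,
    (vandermondeSq φ : ℂ) * (E φ * ∏ _k : Fin n, (1 / (2 * (Real.pi : ℂ))))

variable {n : ℕ}

theorem gapMean_integrable (η θ : ℝ) {E : (Fin n → ℝ) → ℂ} (hE : Continuous E) :
    IntegrableOn (fun φ => (vandermondeSq φ : ℂ) * (E φ * ∏ _k : Fin n, (1 / (2 * (Real.pi : ℂ)))))
      (angleCube n η θ) :=
  (contDiff_vandermondeSq.continuous.mul (hE.mul_const _)).integrableOn_Icc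

theorem gapMean_add (η θ : ℝ) {E G : (Fin n → ℝ) → ℂ} (hE : Continuous E) (hG : Continuous G) :
    gapMean n η θ (fun φ => E φ + G φ) = gapMean n η θ E + gapMean n η θ G := by
  simp only [gapMean, add_mul, mul_add]
  rw [integral_add (gapMean_integrable η θ hE) (gapMean_integrable η θ hG), mul_add]

theorem gapMean_const_mul (η θ : ℝ) (c : ℂ) (E : (Fin n → ℝ) → ℂ) :
    gapMean n η θ (fun φ => c * E φ) = c * gapMean n η θ E := by
  simp only [gapMean]
  rw [mul_left_comm c, ← integral_const_mul c]
  congr 2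
  funext φ
  ring

theorem gapMean_sum (η θ : ℝ) {ι : Type*} (s : Finset ι) {E : ι → (Fin n → ℝ) → ℂ}
    (hE : ∀ i, Continuous (E i)) :
    gapMean n η θ (fun φ => ∑ i ∈ s, E i φ) = ∑ i ∈ s, gapMean n η θ (E i) := by
  classical
  induction s using Finset.induction_on with
  | empty => simp [gapMean]
  | insert i s hi ih =>
    simp only [Finset.sum_insert hi]
    rw [gapMean_add η θ (hE i) (continuous_finsetSum _ fun i _ => hE i), ih]

theorem gapMean_intSum (η θ : ℝ) {E : ℤ → (Fin n → ℝ) → ℂ} (hE : ∀ i, Continuous (E i)) (k : ℤ) :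
    gapMean n η θ (fun φ => intSum (fun j => E j φ) k)
      = intSum (fun j => gapMean n η θ (E j)) k := by
  obtain ⟨m, rfl | rfl⟩ := k.eq_nat_or_neg
  · simp_rw [intSum_natCast]
    exact gapMean_sum η θ _ fun i => hE _
  · simp_rw [intSum_neg_natCast, ← neg_one_mul (Finset.sum _ _)]
    rw [gapMean_const_mul, gapMean_sum η θ _ fun i => hE _]

variable {E : (Fin n → ℝ) → ℂ} {η θ : ℝ}

theorem contDiff_gapMean_integrand (hE : ContDiff ℝ 1 E) : ContDiff ℝ 1 fun φ =>
    (vandermondeSq φ : ℂ) * (E φ * ∏ _k : Fin n, (1 / (2 * (Real.pi : ℂ)))) :=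
  contDiff_vandermondeSq.mul (hE.mul contDiff_const)

theorem differentiableAt_gapMean_right (hE : ContDiff ℝ 1 E) (h : θ < 2 * Real.pi + η) :
    DifferentiableAt ℝ (fun θ' => gapMean n η θ' E) θ :=
  (hasDerivAt_integral_angleCube_right (contDiff_gapMean_integrand hE) h).differentiableAt.const_mul
    _

theorem differentiableAt_gapMean_left (hE : ContDiff ℝ 1 E) (h : θ < 2 * Real.pi + η) :
    DifferentiableAt ℝ (fun η' => gapMean n η' θ E) η :=
  (hasDerivAt_integral_angleCube_left (contDiff_gapMean_integrand hE) h).differentiableAt.const_mul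
    _

/-- The boundary operator acts on the mean of `E` by the quadratic multiplier and the flow. -/
theorem boundaryOp_gapMean (hE : ContDiff ℝ 1 E) (h : θ < 2 * Real.pi + η) (k : ℤ) :
    boundaryOp k (fun η' θ' => gapMean n η' θ' E) η θ
      = gapMean n η θ fun φ => angleQuad k φ * E φ + flow k E φ := by
  have hF := contDiff_gapMean_integrand hE
  have h1 := boundaryOp_integral_angleCube hF h k
  have h2 : boundaryOp k (fun η' θ' => gapMean n η' θ' E) η θ = 1 / (n.factorial : ℂ) *
      boundaryOp k (fun η' θ' => ∫ φ in angleCube n η' θ', (vandermondeSq φ : ℂ) *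
        (E φ * ∏ _k : Fin n, (1 / (2 * (Real.pi : ℂ))))) η θ := by
    simp only [boundaryOp, gapMean]
    rw [deriv_const_mul _ (hasDerivAt_integral_angleCube_right hF h).differentiableAt,
      deriv_const_mul _ (hasDerivAt_integral_angleCube_left hF h).differentiableAt]
    ring
  rw [h2, h1, gapMean]
  congr 2
  funext φ
  have h3 := flow_mul k (contDiff_vandermondeSq.differentiable one_ne_zero φ)
    ((hE.differentiable one_ne_zero φ).mul_const (∏ _k : Fin n, (1 / (2 * (Real.pi : ℂ)))))
  rw [flow_mul k (hE.differentiable one_ne_zero φ) (differentiableAt_const _), flow_const,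
    flow_vandermondeSq] at h3
  simp only [mul_add, Finset.sum_add_distrib]
  have h4 := h3
  rw [flow] at h4
  rw [h4, ← Finset.sum_mul]
  -- The divergence `k p_k` of the field cancels the term `-k p_k` in `flow_vandermondeSq`.
  change anglePowerSum k φ * _ + _ = _
  ring

end GapMean

/-! ### The constraints for formal times. -/

section FormalTau

variable {n : ℕ}

theorem flow_pow {F : (Fin n → ℝ) → ℂ} {φ : Fin n → ℝ} (k : ℤ) (hF : DifferentiableAt ℝ F φ)
    (e : ℕ) : flow k (fun φ => F φ ^ (e + 1)) φ = (e + 1) * F φ ^ e * flow k F φ := by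
  induction e with
  | zero => simp
  | succ e ih =>
    simp_rw [pow_succ _ (e + 1)]
    rw [flow_mul k (hF.fun_pow (e + 1)) hF, ih]
    push_cast
    ring

/-- The coefficients of the weight `∏_k exp(∑_j (t_j z_k^j + s_j z_k^{-j}))`, as functions of the
angles. -/
noncomputable def weightCoeff (m : (ℕ+ ⊕ ℕ+) →₀ ℕ) (φ : Fin n → ℝ) : ℂ :=
  m.prod fun x e => anglePowerSum (weight x) φ ^ e / (e.factorial : ℂ)

theorem powerSum_circlePoint (x : ℕ+ ⊕ ℕ+) (φ : Fin n → ℝ) :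
    powerSum (fun k => circlePoint (φ k)) x = anglePowerSum (weight x) φ := by
  cases x <;> simp [powerSum, anglePowerSum, weight]

theorem coeff_tauSeries (η θ : ℝ) (m : (ℕ+ ⊕ ℕ+) →₀ ℕ) :
    MvPowerSeries.coeff m (tauSeries n η θ) = gapMean n η θ (weightCoeff m) := by
  have h : ∀ φ : Fin n → ℝ, MvPowerSeries.coeff m
      (todaWeightSeries fun k => circlePoint (φ k)) = weightCoeff m φ := fun φ => by
    change (m.prod fun x e => powerSum _ x ^ e / (e.factorial : ℂ)) = _
    simp_rw [powerSum_circlePoint]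
    rfl
  change 1 / (n.factorial : ℂ) * _ = _
  simp_rw [h]
  rfl

theorem weightCoeff_eq_mul (m : (ℕ+ ⊕ ℕ+) →₀ ℕ) {s : Finset (ℕ+ ⊕ ℕ+)} (hs : m.support ⊆ s)
    {x : ℕ+ ⊕ ℕ+} (hx : x ∈ s) (φ : Fin n → ℝ) :
    weightCoeff m φ
      = (∏ y ∈ s.erase x, anglePowerSum (weight y) φ ^ m y / ((m y).factorial : ℂ))
        * (anglePowerSum (weight x) φ ^ m x / ((m x).factorial : ℂ)) := by
  rw [weightCoeff, Finsupp.prod_of_support_subset m hs _ (by simp), Finset.prod_erase_mul _ _ hx]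

theorem support_subset_add_single (m : (ℕ+ ⊕ ℕ+) →₀ ℕ) (x : ℕ+ ⊕ ℕ+) :
    m.support ⊆ (m + Finsupp.single x 1).support := by
  intro y hy
  simp only [Finsupp.mem_support_iff, Finsupp.add_apply] at hy ⊢
  omega

theorem mem_support_add_single (m : (ℕ+ ⊕ ℕ+) →₀ ℕ) (x : ℕ+ ⊕ ℕ+) :
    x ∈ (m + Finsupp.single x 1).support := by
  simp

theorem prod_erase_add_single (m : (ℕ+ ⊕ ℕ+) →₀ ℕ) (s : Finset (ℕ+ ⊕ ℕ+)) (x : ℕ+ ⊕ ℕ+)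
    (f : ℕ+ ⊕ ℕ+ → ℕ → ℂ) :
    ∏ y ∈ s.erase x, f y ((m + Finsupp.single x 1 : (ℕ+ ⊕ ℕ+) →₀ ℕ) y) = ∏ y ∈ s.erase x, f y (m y) :=
  Finset.prod_congr rfl fun y hy => by
    rw [Finsupp.add_apply, Finsupp.single_eq_of_ne (Finset.ne_of_mem_erase hy), add_zero]

/-- The coefficient form of the fact that differentiating the exponential in a time multiplies it by
the power sum of that time. -/
theorem weightCoeff_add_single (m : (ℕ+ ⊕ ℕ+) →₀ ℕ) (x : ℕ+ ⊕ ℕ+) (φ : Fin n → ℝ) :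
    weightCoeff (m + Finsupp.single x 1) φ * (m x + 1)
      = anglePowerSum (weight x) φ * weightCoeff m φ := by
  have hx := mem_support_add_single m x
  rw [weightCoeff_eq_mul _ subset_rfl hx, weightCoeff_eq_mul m (support_subset_add_single m x) hx,
    prod_erase_add_single m _ x fun y e => anglePowerSum (weight y) φ ^ e / (e.factorial : ℂ)]
  simp only [Finsupp.add_apply, Finsupp.single_eq_same, Nat.factorial_succ, pow_succ]
  have : ((m x).factorial : ℂ) ≠ 0 := by exact_mod_cast Nat.factorial_ne_zero _
  have h2 : ((m x : ℂ) + 1) ≠ 0 := Nat.cast_add_one_ne_zero _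
  push_cast
  field_simp

theorem contDiff_weightCoeff (m : (ℕ+ ⊕ ℕ+) →₀ ℕ) : ContDiff ℝ 1 (weightCoeff (n := n) m) :=
  contDiff_prod fun x _ => ((contDiff_anglePowerSum (weight x)).pow _).div_const _

theorem flow_weightCoeff (k : ℤ) (m : (ℕ+ ⊕ ℕ+) →₀ ℕ) (φ : Fin n → ℝ) :
    flow k (weightCoeff m) φ = ∑ x ∈ m.support, (weight x : ℂ) *
      (anglePowerSum (weight x + k) φ * weightCoeff (m - Finsupp.single x 1) φ) := by
  have hd : ∀ x, DifferentiableAt ℝ (anglePowerSum (n := n) (weight x)) φ := fun x =>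
    (contDiff_anglePowerSum (weight x)).differentiable one_ne_zero φ
  have h : flow k (weightCoeff m) φ = _ := flow_prod (s := m.support)
    (F := fun x φ => anglePowerSum (weight x) φ ^ m x / ((m x).factorial : ℂ)) k
    fun x _ => by simpa only [div_eq_mul_inv] using ((hd x).fun_pow (m x)).mul_const _
  rw [h]
  refine Finset.sum_congr rfl fun x hx => ?_
  -- As `x` lies in the support, the truncated subtraction in the statement is a true one.
  obtain ⟨m', rfl⟩ : ∃ m', m = m' + Finsupp.single x 1 :=
    ⟨m - Finsupp.single x 1, (tsub_add_cancel_of_le (Finsupp.single_le_iff.2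
      (Nat.one_le_iff_ne_zero.2 (Finsupp.mem_support_iff.1 hx)))).symm⟩
  rw [add_tsub_cancel_right, weightCoeff_eq_mul m' (support_subset_add_single m' x) hx,
    prod_erase_add_single m' _ x fun y e => anglePowerSum (weight y) φ ^ e / (e.factorial : ℂ)]
  simp only [Finsupp.add_apply, Finsupp.single_eq_same, div_eq_mul_inv]
  rw [flow_mul k ((hd x).fun_pow _) (differentiableAt_const _), flow_const, flow_pow k (hd x),
    flow_anglePowerSum, Nat.factorial_succ]
  have : ((m' x).factorial : ℂ) ≠ 0 := by exact_mod_cast Nat.factorial_ne_zero _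
  have h2 : ((m' x : ℂ) + 1) ≠ 0 := Nat.cast_add_one_ne_zero _
  push_cast
  field_simp
  ring

/-- The power series of means of `g · ∏_k exp(∑_j (t_j z_k^j + s_j z_k^{-j}))`. -/
noncomputable def meanSeries (η θ : ℝ) (g : (Fin n → ℝ) → ℂ) : TimeSeries :=
  fun m => gapMean n η θ fun φ => g φ * weightCoeff m φ

theorem coeff_meanSeries (η θ : ℝ) (g : (Fin n → ℝ) → ℂ) (m : (ℕ+ ⊕ ℕ+) →₀ ℕ) :
    MvPowerSeries.coeff m (meanSeries η θ g) = gapMean n η θ fun φ => g φ * weightCoeff m φ := rfl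

theorem tauSeries_eq_meanSeries (η θ : ℝ) :
    tauSeries n η θ = meanSeries (n := n) η θ fun _ => 1 := by
  ext m
  simp only [coeff_tauSeries, coeff_meanSeries, one_mul]

theorem seriesMode_meanSeries (η θ : ℝ) (g : (Fin n → ℝ) → ℂ) (y : ℤ) :
    seriesMode n y (meanSeries η θ g) = meanSeries η θ fun φ => anglePowerSum y φ * g φ := by
  ext m
  rcases eq_or_ne y 0 with rfl | hy
  · rw [seriesMode_zero, LinearMap.smul_apply, map_smul, Module.End.one_apply, coeff_meanSeries,
      coeff_meanSeries, smul_eq_mul, ← gapMean_const_mul]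
    simp only [anglePowerSum_zero, mul_assoc]
  · obtain ⟨x, rfl⟩ := exists_weight_eq hy
    rw [seriesMode_weight, MvPowerSeries.coeff_pderiv, coeff_meanSeries, coeff_meanSeries,
      mul_comm, ← gapMean_const_mul]
    congr 1
    funext φ
    rw [mul_right_comm, ← weightCoeff_add_single]
    ring

theorem boundaryOp_tauSeries {η θ : ℝ} (h : θ < 2 * Real.pi + η) (k : ℤ)
    (m : (ℕ+ ⊕ ℕ+) →₀ ℕ) :
    boundaryOp k (fun η' θ' => MvPowerSeries.coeff m (tauSeries n η' θ')) η θ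
      = MvPowerSeries.coeff m (virasoro onSeries n k (tauSeries n η θ)) := by
  have hc : ∀ m, Continuous (weightCoeff (n := n) m) := fun m => (contDiff_weightCoeff m).continuous
  have hp := continuous_anglePowerSum (n := n)
  simp_rw [coeff_tauSeries]
  rw [boundaryOp_gapMean (contDiff_weightCoeff m) h k, gapMean_add η θ
    (E := fun φ => angleQuad k φ * weightCoeff m φ)
    ((continuous_angleQuad k).mul (hc m)) (continuous_flow k (contDiff_weightCoeff m)),
    virasoro_onSeries, seriesVirasoro, LinearMap.add_apply, map_add,
    coeff_seriesDrift n k _ m subset_rfl, tauSeries_eq_meanSeries]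
  congr 1
  · have h1 := intSum_map ((MvPowerSeries.coeff m).toAddMonoidHom.comp
      (LinearMap.applyₗ (R := ℂ) (meanSeries (n := n) η θ fun _ => 1)).toAddMonoidHom)
      (fun j => seriesMode n j * seriesMode n (k - j)) k
    refine Eq.trans ?_ h1.symm
    have h2 : ∀ φ : Fin n → ℝ, angleQuad k φ * weightCoeff m φ = intSum (fun j =>
        anglePowerSum j φ * anglePowerSum (k - j) φ * weightCoeff m φ) k := fun φ =>
      intSum_map (AddMonoidHom.mulRight (weightCoeff m φ)) _ k
    simp_rw [h2]
    rw [gapMean_intSum η θ (E := fun j φ =>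
      anglePowerSum j φ * anglePowerSum (k - j) φ * weightCoeff m φ)
      (fun j => ((hp j).mul (hp (k - j))).mul (hc m))]
    congr 1
    funext j
    change _ = MvPowerSeries.coeff m (seriesMode n j (seriesMode n (k - j) (meanSeries η θ _)))
    rw [seriesMode_meanSeries, seriesMode_meanSeries, coeff_meanSeries]
    simp only [mul_one]
  · have h1 : (flow k (weightCoeff (n := n) m)) = fun φ => ∑ x ∈ m.support, (weight x : ℂ) *
      (anglePowerSum (weight x + k) φ * weightCoeff (m - Finsupp.single x 1) φ) :=
      funext (flow_weightCoeff k m)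
    rw [h1, gapMean_sum η θ m.support (E := fun x φ => (weight x : ℂ) *
      (anglePowerSum (weight x + k) φ * weightCoeff (m - Finsupp.single x 1) φ))
      fun x => ((hp _).mul (hc _)).const_mul _]
    refine Finset.sum_congr rfl fun x hx => ?_
    rw [gapMean_const_mul]
    congr 1
    obtain ⟨m', rfl⟩ : ∃ m', m = Finsupp.single x 1 + m' :=
      ⟨m - Finsupp.single x 1, (add_tsub_cancel_of_le (Finsupp.single_le_iff.2
        (Nat.one_le_iff_ne_zero.2 (Finsupp.mem_support_iff.1 hx)))).symm⟩
    rw [add_tsub_cancel_left, MvPowerSeries.X_def, MvPowerSeries.coeff_add_monomial_mul, one_mul,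
      seriesMode_meanSeries, coeff_meanSeries]
    simp only [mul_one]

end FormalTau

/-! ### Convergent times and the exponential weight. -/

section Times

/-- The times, gathered in one family, are admissible if `∑_j j |T_j| < ∞`. -/
def AdmissibleTimes (T : ℕ+ ⊕ ℕ+ → ℂ) : Prop :=
  Summable fun x => ‖(weight x : ℂ)‖ * ‖T x‖

theorem one_le_norm_weight (x : ℕ+ ⊕ ℕ+) : 1 ≤ ‖(weight x : ℂ)‖ := by
  rw [Complex.norm_intCast]
  exact_mod_cast Int.one_le_abs (weight_ne_zero x)

theorem admissibleTimes_sumElim {t s : ℕ+ → ℂ} (ht : Summable fun j : ℕ+ => (j : ℝ) * ‖t j‖)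
    (hs : Summable fun j : ℕ+ => (j : ℝ) * ‖s j‖) : AdmissibleTimes (Sum.elim t s) :=
  Summable.sum _ (by simpa [Function.comp_def, weight] using ht)
    (by simpa [Function.comp_def, weight] using hs)

theorem AdmissibleTimes.summable_norm {T : ℕ+ ⊕ ℕ+ → ℂ} (hT : AdmissibleTimes T) :
    Summable fun x => ‖T x‖ :=
  Summable.of_nonneg_of_le (fun _ => norm_nonneg _)
    (fun x => le_mul_of_one_le_left (norm_nonneg _) (one_le_norm_weight x)) hT

theorem AdmissibleTimes.update {T : ℕ+ ⊕ ℕ+ → ℂ} (hT : AdmissibleTimes T) (x : ℕ+ ⊕ ℕ+) (u : ℂ) :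
    AdmissibleTimes (Function.update T x u) := by
  refine (Summable.update hT x (‖(weight x : ℂ)‖ * ‖u‖)).congr fun y => ?_
  rcases eq_or_ne y x with rfl | h
  · simp
  · simp [h]

/-- The exponent `∑_j (t_j z^j + s_j z^{-j})` at `z = e^{ix}`. -/
noncomputable def potential (T : ℕ+ ⊕ ℕ+ → ℂ) (x : ℝ) : ℂ :=
  ∑' i, T i * circlePoint x ^ weight i

variable {T : ℕ+ ⊕ ℕ+ → ℂ}

theorem AdmissibleTimes.summable_potential (hT : AdmissibleTimes T) (x : ℝ) :
    Summable fun i => T i * circlePoint x ^ weight i :=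
  Summable.of_norm (hT.summable_norm.congr fun i => by
    rw [norm_mul, norm_circlePoint_zpow, mul_one])

theorem todaWeight_circlePoint {t s : ℕ+ → ℂ} (h : AdmissibleTimes (Sum.elim t s)) (x : ℝ) :
    todaWeight t s (circlePoint x) = Complex.exp (potential (Sum.elim t s) x) := by
  have hp := h.summable_potential x
  have h1 := hp.comp_injective Sum.inl_injective
  have h2 := hp.comp_injective Sum.inr_injective
  rw [todaWeight, potential, Summable.tsum_sum h1 h2]
  refine congrArg _ (Eq.trans ?_ (Summable.tsum_add h1 h2))
  simp [weight]

theorem potential_update (hT : AdmissibleTimes T) (y : ℕ+ ⊕ ℕ+) (u : ℂ) (x : ℝ) :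
    potential (Function.update T y u) x = potential T x + (u - T y) * circlePoint x ^ weight y := by
  have h : (fun i => Function.update T y u i * circlePoint x ^ weight i)
      = fun i => T i * circlePoint x ^ weight i
        + if i = y then (u - T y) * circlePoint x ^ weight y else 0 := by
    funext i
    rcases eq_or_ne i y with rfl | h
    · simp; ring
    · simp [h]
  rw [potential, h, Summable.tsum_add (hT.summable_potential x)
    (summable_of_ne_finset_zero (s := {y}) fun i hi => if_neg (by simpa using hi)), tsum_ite_eq]
  rfl

/-- The condition `∑ j |T_j| < ∞` dominates the termwise derivatives uniformly on the circle. -/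
theorem hasDerivAt_potential (hT : AdmissibleTimes T) (x : ℝ) : HasDerivAt (potential T)
    (∑' i, T i * (Complex.I * weight i * circlePoint x ^ weight i)) x :=
  hasDerivAt_tsum (y₀ := x) hT (fun i y => (hasDerivAt_circlePoint_zpow (weight i) y).const_mul (T i))
    (fun i y => by
      rw [norm_mul, norm_mul, norm_mul, Complex.norm_I, norm_circlePoint_zpow, one_mul, mul_one,
        mul_comm])
    (hT.summable_potential x) x

theorem contDiff_potential (hT : AdmissibleTimes T) : ContDiff ℝ 1 (potential T) := by
  refine contDiff_one_iff_deriv.2 ⟨fun x => (hasDerivAt_potential hT x).differentiableAt, ?_⟩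
  rw [funext fun x => (hasDerivAt_potential hT x).deriv]
  refine continuous_tsum (fun i => ?_) hT fun i x => ?_
  · have := continuous_circlePoint_zpow (weight i)
    exact (this.const_mul _).const_mul _
  · rw [norm_mul, norm_mul, norm_mul, Complex.norm_I, norm_circlePoint_zpow, one_mul, mul_one,
      mul_comm]

variable {n : ℕ}

/-- The weight `∏_k exp(∑_j (t_j z_k^j + s_j z_k^{-j}))`, as a function of the angles. -/
noncomputable def expWeight (T : ℕ+ ⊕ ℕ+ → ℂ) (φ : Fin n → ℝ) : ℂ :=
  ∏ a, Complex.exp (potential T (φ a))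

theorem contDiff_expWeight (hT : AdmissibleTimes T) : ContDiff ℝ 1 (expWeight (n := n) T) :=
  contDiff_prod fun a _ => ((contDiff_potential hT).comp (contDiff_apply ℝ ℝ a)).cexp

theorem continuous_expWeight (hT : AdmissibleTimes T) : Continuous (expWeight (n := n) T) :=
  (contDiff_expWeight hT).continuous

theorem tau_eq_gapMean {t s : ℕ+ → ℂ} (h : AdmissibleTimes (Sum.elim t s)) (η θ : ℝ) :
    tau n t s η θ = gapMean n η θ (expWeight (Sum.elim t s)) := by
  simp only [tau, gapMean, todaWeight_circlePoint h, Finset.prod_mul_distrib]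
  rfl

theorem expWeight_update (hT : AdmissibleTimes T) (y : ℕ+ ⊕ ℕ+) (u : ℂ) (φ : Fin n → ℝ) :
    expWeight (Function.update T y u) φ
      = expWeight T φ * Complex.exp ((u - T y) * anglePowerSum (weight y) φ) := by
  simp only [expWeight, potential_update hT, Complex.exp_add, Finset.prod_mul_distrib,
    anglePowerSum, Finset.mul_sum, Complex.exp_sum]

/-- Each factor has as logarithmic derivative an absolutely convergent series in the powers of its
own `z_a`; summing over `a` turns these powers into power sums. -/
theorem flow_expWeight (hT : AdmissibleTimes T) (k : ℤ) (φ : Fin n → ℝ) :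
    flow k (expWeight T) φ
      = (∑' i, (weight i : ℂ) * (T i * anglePowerSum (weight i + k) φ)) * expWeight T φ := by
  have hd := fun a => (hasDerivAt_potential hT (φ a)).cexp
  have hdiff : ∀ a : Fin n, DifferentiableAt ℝ
      (fun φ : Fin n → ℝ => Complex.exp (potential T (φ a))) φ := fun a =>
    (((contDiff_potential hT).comp (contDiff_apply ℝ ℝ a)).cexp.differentiable one_ne_zero) φ
  have h : flow k (expWeight T) φ = _ := flow_prod_of_eq_mul (s := Finset.univ)
    (F := fun (a : Fin n) φ => Complex.exp (potential T (φ a)))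
    (q := fun a => ∑' i, (weight i : ℂ) * (T i * circlePoint (φ a) ^ (weight i + k))) k
    (fun a _ => hdiff a) (fun a _ => by
      rw [flow_comp_apply k a (hd a)]
      have e : ∑' i, (weight i : ℂ) * (T i * circlePoint (φ a) ^ (weight i + k))
          = circlePoint (φ a) ^ k * (1 / Complex.I *
            ∑' i, T i * (Complex.I * weight i * circlePoint (φ a) ^ weight i)) := by
        rw [← tsum_mul_left, ← tsum_mul_left]
        refine tsum_congr fun i => ?_
        rw [zpow_add₀ (circlePoint_ne_zero _)]
        have := Complex.I_ne_zero
        field_simp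
      rw [e]
      ring)
  rw [h, mul_comm]
  congr 1
  rw [← Summable.tsum_finsetSum fun a _ => ?_]
  · simp only [anglePowerSum, Finset.mul_sum]
  · exact Summable.of_norm (hT.congr fun i => by
      rw [norm_mul, norm_mul, norm_circlePoint_zpow, mul_one])

end Times

/-! ### Derivatives in the times and series under the mean. -/

section GapMeanTimes

variable {n : ℕ} {T : ℕ+ ⊕ ℕ+ → ℂ}

/-- Differentiation with respect to a time inserts a power sum. -/
theorem hasDerivAt_gapMean_update (hT : AdmissibleTimes T) (η θ : ℝ) {g : (Fin n → ℝ) → ℂ}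
    (hg : Continuous g) (y : ℕ+ ⊕ ℕ+) :
    HasDerivAt (fun u => gapMean n η θ fun φ => g φ * expWeight (Function.update T y u) φ)
      (gapMean n η θ fun φ => anglePowerSum (weight y) φ * g φ * expWeight T φ) (T y) := by
  have hD := (contDiff_vandermondeSq (n := n)).continuous
  have hD' : Continuous fun p : ℂ × (Fin n → ℝ) => (vandermondeSq p.2 : ℂ) :=
    hD.comp continuous_snd
  have hE := continuous_expWeight (n := n) hT
  have hp := continuous_anglePowerSum (n := n) (weight y)
  simp_rw [expWeight_update hT]
  set c : ℂ := ∏ _k : Fin n, (1 / (2 * (Real.pi : ℂ))) with hc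
  have key := hasDerivAt_setIntegral_of_continuous (𝕜 := ℂ) (μ := (volume : Measure (Fin n → ℝ)))
    (K := angleCube n η θ) isCompact_Icc
    (f := fun u φ => (vandermondeSq φ : ℂ) * (g φ * (expWeight T φ *
      Complex.exp ((u - T y) * anglePowerSum (weight y) φ)) * c))
    (f' := fun u φ => (vandermondeSq φ : ℂ) * (g φ * (expWeight T φ *
      (Complex.exp ((u - T y) * anglePowerSum (weight y) φ) * anglePowerSum (weight y) φ)) * c))
    (fun u => by fun_prop) (by simp only [Function.uncurry_def]; fun_prop)
    (fun u φ => by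
      have h1 : HasDerivAt (fun u => (u - T y) * anglePowerSum (weight y) φ)
          (anglePowerSum (weight y) φ) u := by
        simpa using ((hasDerivAt_id u).sub_const (T y)).mul_const (anglePowerSum (weight y) φ)
      exact (((h1.cexp.const_mul _).const_mul _).mul_const _).const_mul _) (T y)
  refine (key.const_mul (1 / (n.factorial : ℂ))).congr_deriv ?_
  rw [gapMean]
  congr 2
  funext φ
  rw [sub_self, zero_mul, Complex.exp_zero, ← hc]
  ring

theorem norm_gapMean_mul_le (η θ : ℝ) {g E : (Fin n → ℝ) → ℂ} (hE : Continuous E) {B : ℝ}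
    (hB : ∀ φ, ‖g φ‖ ≤ B) :
    ‖gapMean n η θ fun φ => g φ * E φ‖ ≤ B * (‖1 / (n.factorial : ℂ)‖ *
      ∫ φ in angleCube n η θ,
        ‖(vandermondeSq φ : ℂ) * (E φ * ∏ _k : Fin n, (1 / (2 * (Real.pi : ℂ))))‖) := by
  rw [gapMean, norm_mul, mul_left_comm, ← integral_const_mul]
  gcongr
  refine norm_integral_le_of_norm_le ((gapMean_integrable η θ hE).norm.const_mul B)
    (Filter.Eventually.of_forall fun φ => ?_)
  rw [show (vandermondeSq φ : ℂ) * (g φ * E φ * ∏ _k : Fin n, (1 / (2 * (Real.pi : ℂ))))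
    = g φ * ((vandermondeSq φ : ℂ) * (E φ * ∏ _k : Fin n, (1 / (2 * (Real.pi : ℂ))))) by ring,
    norm_mul]
  exact mul_le_mul_of_nonneg_right (hB φ) (norm_nonneg _)

theorem gapMean_tsum_mul {ι : Type*} [Countable ι] (η θ : ℝ) {g : ι → (Fin n → ℝ) → ℂ}
    {E : (Fin n → ℝ) → ℂ} (hg : ∀ i, Continuous (g i)) (hE : Continuous E) {u : ι → ℝ}
    (hu : Summable u) (hB : ∀ i φ, ‖g i φ‖ ≤ u i) :
    gapMean n η θ (fun φ => (∑' i, g i φ) * E φ)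
      = ∑' i, gapMean n η θ fun φ => g i φ * E φ := by
  set W : (Fin n → ℝ) → ℂ := fun φ =>
    (vandermondeSq φ : ℂ) * (E φ * ∏ _k : Fin n, (1 / (2 * (Real.pi : ℂ)))) with hW
  have hWc : Continuous W := contDiff_vandermondeSq.continuous.mul (hE.mul_const _)
  have hcont : ∀ i, Continuous fun φ => g i φ * W φ := fun i => (hg i).mul hWc
  have key := integral_tsum_of_summable_integral_norm (μ := volume.restrict (angleCube n η θ))
    (F := fun i φ => g i φ * W φ) (fun i => (hcont i).integrableOn_Icc) (by
      refine Summable.of_nonneg_of_le (fun i => integral_nonneg fun φ => norm_nonneg _)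
        (fun i => ?_) (hu.mul_right (∫ φ in angleCube n η θ, ‖W φ‖))
      rw [← integral_const_mul]
      refine integral_mono (hcont i).norm.integrableOn_Icc
        (hWc.norm.integrableOn_Icc.const_mul _) fun φ => ?_
      simp only [norm_mul]
      exact mul_le_mul_of_nonneg_right (hB i φ) (by positivity))
  have hpull : ∀ h : (Fin n → ℝ) → ℂ, gapMean n η θ (fun φ => h φ * E φ)
      = 1 / (n.factorial : ℂ) * ∫ φ in angleCube n η θ, h φ * W φ := fun h => by
    rw [gapMean]
    congr 2
    funext φ
    simp only [hW]
    ring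
  simp_rw [hpull]
  rw [tsum_mul_left, key]
  simp_rw [tsum_mul_right]

end GapMeanTimes

/-! ### The constraints for convergent times. -/

section FunctionTau

variable {n : ℕ} {η θ : ℝ}

/-- `Φ` is, at admissible times, the mean of `g` against the Toda weight. -/
def IsTodaMean (n : ℕ) (η θ : ℝ) (Φ : (ℕ+ → ℂ) → (ℕ+ → ℂ) → ℂ) (g : (Fin n → ℝ) → ℂ) : Prop :=
  ∀ t s, AdmissibleTimes (Sum.elim t s) →
    Φ t s = gapMean n η θ fun φ => g φ * expWeight (Sum.elim t s) φ

theorem isTodaMean_tau (n : ℕ) (η θ : ℝ) :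
    IsTodaMean n η θ (fun t s => tau n t s η θ) fun _ => 1 := fun t s h => by
  simp only [tau_eq_gapMean h, one_mul]

variable {Φ : (ℕ+ → ℂ) → (ℕ+ → ℂ) → ℂ} {g : (Fin n → ℝ) → ℂ} {t s : ℕ+ → ℂ}

theorem IsTodaMean.hasDerivAt_t (hΦ : IsTodaMean n η θ Φ g) (hg : Continuous g)
    (h : AdmissibleTimes (Sum.elim t s)) (j : ℕ+) :
    HasDerivAt (fun u => Φ (Function.update t j u) s) (gapMean n η θ fun φ =>
      anglePowerSum (weight (Sum.inl j)) φ * g φ * expWeight (Sum.elim t s) φ) (t j) := by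
  have hu := fun u => h.update (Sum.inl j) u
  simp_rw [Sum.update_elim_inl] at hu
  have := hasDerivAt_gapMean_update h η θ hg (Sum.inl j)
  simp_rw [Sum.update_elim_inl] at this
  simpa only [hΦ _ _ (hu _), Sum.elim_inl] using this

theorem IsTodaMean.hasDerivAt_s (hΦ : IsTodaMean n η θ Φ g) (hg : Continuous g)
    (h : AdmissibleTimes (Sum.elim t s)) (j : ℕ+) :
    HasDerivAt (fun u => Φ t (Function.update s j u)) (gapMean n η θ fun φ =>
      anglePowerSum (weight (Sum.inr j)) φ * g φ * expWeight (Sum.elim t s) φ) (s j) := by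
  have hu := fun u => h.update (Sum.inr j) u
  simp_rw [Sum.update_elim_inr] at hu
  have := hasDerivAt_gapMean_update h η θ hg (Sum.inr j)
  simp_rw [Sum.update_elim_inr] at this
  simpa only [hΦ _ _ (hu _), Sum.elim_inr] using this

/-- Changing one time preserves admissibility, so the derivative sees only admissible times and is
again a Toda mean. The lemma can therefore be iterated, which yields the second derivatives. -/
theorem IsTodaMean.mode (hΦ : IsTodaMean n η θ Φ g) (hg : Continuous g) (y : ℤ) :
    IsTodaMean n η θ (onFunctions.mode n y Φ) fun φ => anglePowerSum y φ * g φ := by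
  intro t s h
  rcases eq_or_ne y 0 with rfl | hy
  · simp only [TimeOps.mode_zero, anglePowerSum_zero, mul_assoc, gapMean_const_mul]
    change (n : ℂ) * Φ t s = _
    rw [hΦ t s h]
  · obtain ⟨x, rfl⟩ := exists_weight_eq hy
    rw [TimeOps.mode_weight]
    cases x with
    | inl j => exact (hΦ.hasDerivAt_t hg h j).deriv
    | inr j => exact (hΦ.hasDerivAt_s hg h j).deriv

theorem onFunctions_mul_apply (x : ℕ+ ⊕ ℕ+) (Φ : (ℕ+ → ℂ) → (ℕ+ → ℂ) → ℂ) (t s : ℕ+ → ℂ) :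
    onFunctions.mul x Φ t s = Sum.elim t s x * Φ t s := by
  cases x <;> rfl

/-- On the circle every power sum is at most `n` in absolute value, so a single constant bounds all
the modes and admissibility gives the convergence. -/
theorem IsTodaMean.summable_drift (hΦ : IsTodaMean n η θ Φ fun _ => 1)
    (h : AdmissibleTimes (Sum.elim t s)) (k : ℤ) :
    Summable fun x => (weight x : ℂ) *
      (Sum.elim t s x * onFunctions.mode n (weight x + k) Φ t s) := by
  set C := (n : ℝ) * (‖1 / (n.factorial : ℂ)‖ * ∫ φ in angleCube n η θ,
    ‖(vandermondeSq φ : ℂ) * (expWeight (Sum.elim t s) φ *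
      ∏ _k : Fin n, (1 / (2 * (Real.pi : ℂ))))‖)
  refine Summable.of_norm_bounded (Summable.mul_right C h) fun x => ?_
  rw [hΦ.mode continuous_const (weight x + k) t s h, norm_mul, norm_mul, ← mul_assoc]
  gcongr
  simp only [mul_one]
  exact norm_gapMean_mul_le η θ (continuous_expWeight h) fun φ => norm_anglePowerSum_le _ φ

theorem IsTodaMean.virasoroDefinedAt (hΦ : IsTodaMean n η θ Φ fun _ => 1)
    (h : AdmissibleTimes (Sum.elim t s)) : VirasoroDefinedAt Φ t s := by
  have hdt : ∀ (j : ℕ+) (y : ℤ), y = ((j : ℕ) : ℤ) → onFunctions.mode n y Φ = onFunctions.dt j Φ :=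
    fun j y hy => by rw [hy, TimeOps.mode_natCast]
  have hds : ∀ (j : ℕ+) (y : ℤ), y = -((j : ℕ) : ℤ) → onFunctions.mode n y Φ = onFunctions.ds j Φ :=
    fun j y hy => by rw [hy, TimeOps.mode_neg_natCast]
  have hst : ∀ k : ℤ, Summable fun j : ℕ+ =>
      (j : ℂ) * (t j * onFunctions.mode n (((j : ℕ) : ℤ) + k) Φ t s) := fun k => by
    simpa [Function.comp_def, weight] using
      (hΦ.summable_drift h k).comp_injective Sum.inl_injective
  have hss : ∀ k : ℤ, Summable fun j : ℕ+ =>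
      (j : ℂ) * (s j * onFunctions.mode n (-((j : ℕ) : ℤ) + k) Φ t s) := fun k => by
    simpa [Function.comp_def, weight] using
      ((hΦ.summable_drift h k).comp_injective Sum.inr_injective).neg
  have hsub : ∀ {j k : ℕ+}, k < j → ((j - k : ℕ+) : ℕ) + (k : ℕ) = j := fun hkj => by
    rw [add_comm]; exact_mod_cast PNat.add_sub_of_lt hkj
  have hcont := fun y : ℤ => (continuous_anglePowerSum (n := n) y).mul
    (continuous_const (y := (1 : ℂ)))
  refine ⟨fun j => (hΦ.hasDerivAt_t continuous_const h j).differentiableAt,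
    fun j => (hΦ.hasDerivAt_s continuous_const h j).differentiableAt, fun i j => ?_, fun i j => ?_,
    (hst 0).congr fun j => ?_, (hss 0).congr fun j => ?_, fun k => (hst k).congr fun j => ?_,
    fun k => (hss (-k)).congr fun j => ?_, fun k => (summable_ite_lt (hst (-k)) k).congr fun j => ?_,
    fun k => (summable_ite_lt (hss k) k).congr fun j => ?_⟩
  · rw [← hdt j _ rfl]
    exact ((hΦ.mode continuous_const _).hasDerivAt_t (hcont _) h i).differentiableAt
  · rw [← hds j _ rfl]
    exact ((hΦ.mode continuous_const _).hasDerivAt_s (hcont _) h i).differentiableAt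
  · rw [hdt j _ (by ring)]
  · rw [hds j _ (by ring)]
  · rw [hdt (j + k) _ (by push_cast; ring)]
  · rw [hds (j + k) _ (by push_cast; ring)]
  · split_ifs with hj
    · rw [hdt (j - k) _ (by have := hsub hj; omega)]
    · rfl
  · split_ifs with hj
    · rw [hds (j - k) _ (by have := hsub hj; omega)]
    · rfl

theorem IsTodaMean.virasoro_eq (hΦ : IsTodaMean n η θ Φ fun _ => 1)
    (h : AdmissibleTimes (Sum.elim t s)) (k : ℤ) :
    virasoro onFunctions n k Φ t s = gapMean n η θ fun φ =>
      angleQuad k φ * expWeight (Sum.elim t s) φ + flow k (expWeight (Sum.elim t s)) φ := by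
  have hE := continuous_expWeight (n := n) h
  have hp := continuous_anglePowerSum (n := n)
  have h1 := apply_virasoro onFunctions n
    ((LinearMap.proj (R := ℂ) (φ := fun _ : ℕ+ → ℂ => ℂ) s).comp
      (LinearMap.proj (R := ℂ) (φ := fun _ : ℕ+ → ℂ => (ℕ+ → ℂ) → ℂ) t)) Φ
    (fun j => by
      funext t' s'
      exact deriv_const_mul_field (n : ℂ))
    (fun x c Ψ => by
      funext t' s'
      simp only [onFunctions_mul_apply, Pi.smul_apply, smul_eq_mul]
      ring)
    (fun _ _ _ _ => rfl) k
    (by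
      simpa only [LinearMap.comp_apply, LinearMap.proj_apply, onFunctions_mul_apply]
        using hΦ.summable_drift h k)
  simp only [LinearMap.comp_apply, LinearMap.proj_apply, onFunctions_mul_apply] at h1
  rw [h1, gapMean_add η θ (E := fun φ => angleQuad k φ * expWeight (Sum.elim t s) φ)
    ((continuous_angleQuad k).mul hE) (continuous_flow k (contDiff_expWeight h))]
  congr 1
  · have h2 : ∀ φ : Fin n → ℝ, angleQuad k φ * expWeight (Sum.elim t s) φ = intSum (fun j =>
        anglePowerSum j φ * anglePowerSum (k - j) φ * expWeight (Sum.elim t s) φ) k := fun φ =>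
      intSum_map (AddMonoidHom.mulRight (expWeight (Sum.elim t s) φ)) _ k
    simp_rw [h2]
    rw [gapMean_intSum η θ (E := fun j φ =>
      anglePowerSum j φ * anglePowerSum (k - j) φ * expWeight (Sum.elim t s) φ)
      (fun j => ((hp j).mul (hp (k - j))).mul hE)]
    congr 1
    funext j
    rw [(hΦ.mode continuous_const (k - j)).mode ((hp _).mul continuous_const) j t s h]
    simp only [mul_one]
  · rw [funext (flow_expWeight h k), gapMean_tsum_mul η θ (fun i => ((hp _).const_mul _).const_mul _) hE
      (Summable.mul_right (n : ℝ) h) fun i φ => by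
        rw [norm_mul, norm_mul, ← mul_assoc]
        gcongr
        exact norm_anglePowerSum_le _ φ]
    refine tsum_congr fun x => ?_
    rw [hΦ.mode continuous_const (weight x + k) t s h, ← gapMean_const_mul, ← gapMean_const_mul]
    congr 1
    funext φ
    ring

theorem boundaryOp_tau (h : AdmissibleTimes (Sum.elim t s)) (hηθ : θ < 2 * Real.pi + η) (k : ℤ) :
    boundaryOp k (fun η' θ' => tau n t s η' θ') η θ
      = virasoro onFunctions n k (fun t' s' => tau n t' s' η θ) t s := by
  rw [(isTodaMean_tau n η θ).virasoro_eq h k]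
  simp_rw [tau_eq_gapMean h]
  exact boundaryOp_gapMean (contDiff_expWeight h) hηθ k

end FunctionTau

end CircularEnsemble

theorem theorem2p2 (n : ℕ) (hn : 1 ≤ n) :
    -- (i), for actual times
    (∀ t s : ℕ+ → ℂ,
      Summable (fun j : ℕ+ => (j : ℝ) * ‖t j‖) → Summable (fun j : ℕ+ => (j : ℝ) * ‖s j‖) →
      ∀ η θ : ℝ, -Real.pi < η → η ≤ θ → θ < Real.pi →
        DifferentiableAt ℝ (fun θ' : ℝ => CircularEnsemble.tau n t s η θ') θ ∧
        DifferentiableAt ℝ (fun η' : ℝ => CircularEnsemble.tau n t s η' θ) η ∧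
        CircularEnsemble.VirasoroDefinedAt
          (fun t' s' => CircularEnsemble.tau n t' s' η θ) t s ∧
        ∀ k : ℤ,
          CircularEnsemble.boundaryOp k (fun η' θ' => CircularEnsemble.tau n t s η' θ') η θ =
            CircularEnsemble.virasoro CircularEnsemble.onFunctions n k
              (fun t' s' => CircularEnsemble.tau n t' s' η θ) t s) ∧
    -- (i), for formal times, coefficient by coefficient
    (∀ (η θ : ℝ), -Real.pi < η → η ≤ θ → θ < Real.pi → ∀ m : (ℕ+ ⊕ ℕ+) →₀ ℕ,
        DifferentiableAt ℝ
          (fun θ' : ℝ => MvPowerSeries.coeff m (CircularEnsemble.tauSeries n η θ')) θ ∧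
        DifferentiableAt ℝ
          (fun η' : ℝ => MvPowerSeries.coeff m (CircularEnsemble.tauSeries n η' θ)) η ∧
        ∀ k : ℤ,
          CircularEnsemble.boundaryOp k
              (fun η' θ' => MvPowerSeries.coeff m (CircularEnsemble.tauSeries n η' θ')) η θ =
            MvPowerSeries.coeff m
              (CircularEnsemble.virasoro CircularEnsemble.onSeries n k
                (CircularEnsemble.tauSeries n η θ))) ∧
    -- (ii), on the space of formal power series in the times
    (∀ (k l : ℤ) (f : CircularEnsemble.TimeSeries),
        CircularEnsemble.virasoro CircularEnsemble.onSeries n k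
            (CircularEnsemble.virasoro CircularEnsemble.onSeries n l f)
          - CircularEnsemble.virasoro CircularEnsemble.onSeries n l
              (CircularEnsemble.virasoro CircularEnsemble.onSeries n k f) =
          ((k : ℂ) - (l : ℂ)) •
            CircularEnsemble.virasoro CircularEnsemble.onSeries n (k + l) f) := by
  -- The angular interval `[θ, 2π + η]` has positive length; this is all that is used about the
  -- position of `η` and `θ`.
  have hlt : ∀ {η θ : ℝ}, -Real.pi < η → θ < Real.pi → θ < 2 * Real.pi + η := fun h1 h2 => by
    linarith
  refine ⟨fun t s ht hs η θ h1 _ h2 => ?_, fun η θ h1 _ h2 m => ?_,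
    CircularEnsemble.virasoro_onSeries_commutator n⟩
  · have h := CircularEnsemble.admissibleTimes_sumElim ht hs
    refine ⟨?_, ?_, (CircularEnsemble.isTodaMean_tau n η θ).virasoroDefinedAt h,
      CircularEnsemble.boundaryOp_tau h (hlt h1 h2)⟩
    · simp_rw [CircularEnsemble.tau_eq_gapMean h]
      exact CircularEnsemble.differentiableAt_gapMean_right
        (CircularEnsemble.contDiff_expWeight h) (hlt h1 h2)
    · simp_rw [CircularEnsemble.tau_eq_gapMean h]
      exact CircularEnsemble.differentiableAt_gapMean_left
        (CircularEnsemble.contDiff_expWeight h) (hlt h1 h2)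
  · refine ⟨?_, ?_, fun k => CircularEnsemble.boundaryOp_tauSeries (hlt h1 h2) k m⟩
    · simp_rw [CircularEnsemble.coeff_tauSeries]
      exact CircularEnsemble.differentiableAt_gapMean_right
        (CircularEnsemble.contDiff_weightCoeff m) (hlt h1 h2)
    · simp_rw [CircularEnsemble.coeff_tauSeries]
      exact CircularEnsemble.differentiableAt_gapMean_left
        (CircularEnsemble.contDiff_weightCoeff m) (hlt h1 h2)
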